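/- Let $p$ be a prime number, $N\ge 0$ and $d\ge 2$ integers, and $c\in\mathbb{C}_p$. Let $v_p$ be the $p$-adic valuation on $\mathbb{C}_p$ with $v_p(p)=1$ and $v_p(0)=\infty$, and put $|x|_p=p^{-v_p(x)}$. Assume one of the following two conditions. (A) $N=0$, $d$ is a multiple of $p$, and $v_p(c)<v_p(d)+\dfrac{v_p((d-1)!)}{d-1}$. (B) $N\ge 1$, $d$ is a power of $p$, and $N v_p(d)+\dfrac{v_p((d-1)!)}{d-1}<v_p(c)<(N+1)v_p(d)+\dfrac{v_p((d-1)!)}{d-1}$. Put $r_N=\left(|c/d^{N+1}|_p\,p^{1/(p-1)}\right)^{1/d^N}$ and $D(0,r_N^{-1})=\{x\in\mathbb{C}_p:|x|_p<r_N^{-1}\}$, and let $g_c(x)=x^d+cx^{d+1}$. Then $r_N>1$, and there is a unique formal power series $\phi_c(x)=x+O(x^2)\in\mathbb{C}_p[[x]]$ (the Böttcher coordinate of $g_c$) satisfying $\phi_c(g_c(x))=\phi_c(x)^d$. Let $\phi_c^{-1}(x)$ be its inverse under composition of formal power series. Then $D(0,r_N^{-1})$ is the largest open disk centered at $0$ on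 which the series $\phi_c(x)$ converges, and it is also the largest open disk centered at $0$ on which the series $\phi_c^{-1}(x)$ converges. Moreover, $x\mapsto\phi_c(x)$ is a bijective isometry from $D(0,r_N^{-1})$ onto itself. -/

import Mathlib

open PowerSeries

noncomputable section

/-- The `p`-adic valuation on `ℂ_p`, normalized by `v_p(p) = 1`, with `v_p(0) = ∞`. -/
def padicV (p : ℕ) [Fact p.Prime] (x : ℂ_[p]) : EReal :=
  open Classical in if x = 0 then ⊤ else ((-Real.logb p ‖x‖ : ℝ) : EReal)

/-- The number `N * v_p(d) + v_p((d-1)!) / (d-1)`. -/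
def condBound (p N d : ℕ) : ℝ :=
  (N : ℝ) * (padicValNat p d : ℝ) +
    (padicValNat p (Nat.factorial (d - 1)) : ℝ) / ((d : ℝ) - 1)

/-- Condition A: `N = 0`, `d` is a multiple of `p`, and
`v_p(c) < v_p(d) + v_p((d-1)!)/(d-1)`. -/
def ConditionA (p : ℕ) [Fact p.Prime] (N d : ℕ) (c : ℂ_[p]) : Prop :=
  N = 0 ∧ p ∣ d ∧ padicV p c < (condBound p 1 d : EReal)

/-- Condition B: `N ≥ 1`, `d` is a power of `p`, and
`N v_p(d) + v_p((d-1)!)/(d-1) < v_p(c) < (N+1) v_p(d) + v_p((d-1)!)/(d-1)`. -/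
def ConditionB (p : ℕ) [Fact p.Prime] (N d : ℕ) (c : ℂ_[p]) : Prop :=
  1 ≤ N ∧ (∃ k : ℕ, d = p ^ k) ∧
    (condBound p N d : EReal) < padicV p c ∧ padicV p c < (condBound p (N + 1) d : EReal)

/-- `r_N = (|c / d^(N+1)|_p * p^(1/(p-1)))^(1/d^N)`. -/
def rN (p : ℕ) [Fact p.Prime] (N d : ℕ) (c : ℂ_[p]) : ℝ :=
  (‖c / (d : ℂ_[p]) ^ (N + 1)‖ * (p : ℝ) ^ (1 / ((p : ℝ) - 1))) ^ (1 / (d : ℝ) ^ N)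

/-- The power series `g_c(x) = x^d + c x^(d+1)`. -/
def gSeries {K : Type*} [Field K] (d : ℕ) (c : K) : K⟦X⟧ :=
  X ^ d + C c * X ^ (d + 1)

/-- `φ` is a Böttcher coordinate of `g = x^d + O(x^(d+1))`:
`φ(x) = x + O(x^2)` and `φ(g(x)) = φ(x)^d` as formal power series. -/
structure IsBottcherCoordinate {K : Type*} [Field K] (d : ℕ) (g φ : K⟦X⟧) : Prop where
  constantCoeff_eq : constantCoeff φ = 0
  coeff_one_eq : coeff 1 φ = 1
  bottcher_eq : φ.subst g = φ ^ d

theorem IsBottcherCoordinate.isUnit_coeff_one {K : Type*} [Field K] {d : ℕ} {g φ : K⟦X⟧}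
    (h : IsBottcherCoordinate d g φ) : IsUnit (coeff 1 φ) := by
  rw [h.coeff_one_eq]; exact isUnit_one

/-- `f` converges at `x`. (In `ℂ_p`, convergence of the partial sums, unconditional convergence,
and convergence of the terms to `0` are all equivalent.) -/
def ConvergesAt {p : ℕ} [Fact p.Prime] (f : ℂ_[p]⟦X⟧) (x : ℂ_[p]) : Prop :=
  Summable fun n : ℕ => coeff n f * x ^ n

/-- The open disk `D(0, r)` is the largest open disk centered at `0` on which `f` converges. -/
def IsMaximalConvergentOpenDisk {p : ℕ} [Fact p.Prime] (f : ℂ_[p]⟦X⟧) (r : ℝ) : Prop :=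
  IsGreatest {R : ℝ | ∀ x ∈ Metric.ball (0 : ℂ_[p]) R, ConvergesAt f x} r

/-- The function `x ↦ f(x)` given by a power series, meaningful where `f` converges. -/
def evalSeries {p : ℕ} [Fact p.Prime] (f : ℂ_[p]⟦X⟧) (x : ℂ_[p]) : ℂ_[p] :=
  ∑' n : ℕ, coeff n f * x ^ n

/-- `f` maps the set `D` bijectively and isometrically onto itself. -/
def IsBijectiveIsometryOn {M : Type*} [MetricSpace M] (f : M → M) (D : Set M) : Prop :=
  Set.BijOn f D D ∧ ∀ x ∈ D, ∀ y ∈ D, dist (f x) (f y) = dist x y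

end

/-!
The equation `φ(g(x)) = φ(x) ^ d` has the formal solution `φ(x) = x u(x)`,
`u = ∏_k F_k`, `F_k = (1 + c g_k(x)) ^ (1 / d ^ (k + 1))`, where `g_k` is the `k`-th iterate of
`g = gSeries d c`. As `F_k = 1 + O(x ^ (d ^ k))`, the product converges `X`-adically, and comparing
`u ^ d = (1 + c x) u(g(x))` with the same equation for the partial products shows that it is the only
solution (`X_pow_dvd_sub_bottcherProd`, `existsUnique_isBottcherCoordinate`).

Put `μ = p ^ (-1 / (p - 1))`. By Legendre's formula the `n`-th coefficient of `(1 + x) ^ r`, for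
`|r| > 1`, has norm `μ ^ s(n)` relative to the radius `μ / |r|`, where `s(n)` is the sum of the
`p`-adic digits of `n` (`norm_coeff_binomialSeries_mul`). Hence `F_k - 1` has Gauss norm at most `μ`
at the radius `1 / r_k` given by `‖c‖ r_k ^ (-d ^ k) = μ ‖d‖ ^ (k + 1)`, and the terms `n = p ^ j`
attain `μ`. The hypotheses on `c` say that `r_k` has a strict maximum at `k = N`
(`exists_radii`). So at the radius `ρ = 1 / r_N` every factor satisfies the bound, `u - 1` has Gauss
norm at most `μ < 1`, and `φ` is an isometry of the disk of radius `ρ`, onto by the contraction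
principle (`isBijectiveIsometryOn_ball`).

On the other hand all `F_k` with `k ≠ N` are units, bounded along with their inverses, on a
slightly larger disk. If `φ` converged there, `F_N` would be bounded there, but `g_N` is
`x ^ (d ^ N)` up to a relative error less than `1`, so the coefficients of `F_N` of index `d ^ N p ^ j`
have norm exactly `μ` relative to the radius `ρ` for every `j` (`not_coeffBound_of_lt`).

The bound `μ ρ` for `φ - x` passes to the compositional inverse `ψ` (`CoeffBound.of_subst_eq_X`).
If `ψ` converged on a larger disk, interpolating between the radii would give the bound `ρ'` for
`ψ - x` at some `ρ' > ρ` (`CoeffBound.exists_gt_of_lt`), which passes back to `φ`: a contradiction.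
-/

namespace PowerSeries

/-! ### Congruences modulo powers of `X` -/

section Congruence

variable {K : Type*} [Field K]

theorem X_pow_dvd_subst_sub_subst {f a b : K⟦X⟧} (ha : HasSubst a) (hb : HasSubst b) {i : ℕ}
    (h : ∀ k, coeff k f = 0 ∨ X ^ i ∣ a ^ k - b ^ k) : X ^ i ∣ f.subst a - f.subst b := by
  rw [X_pow_dvd_iff]
  intro m hm
  rw [map_sub, coeff_subst' ha, coeff_subst' hb, sub_eq_zero]
  refine finsum_congr fun k => ?_
  rcases h k with h | h
  · simp [h]
  · have := X_pow_dvd_iff.1 h m hm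
    rw [map_sub, sub_eq_zero] at this
    rw [this]

theorem X_pow_dvd_subst_sub_subst_left {a b g : K⟦X⟧} (hg : HasSubst g) {i j : ℕ}
    (hgX : X ^ j ∣ g) (h : X ^ i ∣ a - b) : X ^ (j * i) ∣ a.subst g - b.subst g := by
  obtain ⟨r, hr⟩ := h
  rw [← subst_sub hg, hr, subst_mul hg, subst_pow hg, subst_X hg, pow_mul]
  exact Dvd.dvd.mul_right (pow_dvd_pow_of_dvd hgX i) _

theorem X_pow_dvd_sub_of_pow_sub_pow [CharZero K] {a b : K⟦X⟧} (ha : constantCoeff a = 1)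
    (hb : constantCoeff b = 1) {n : ℕ} (hn : n ≠ 0) {i : ℕ} (h : X ^ i ∣ a ^ n - b ^ n) :
    X ^ i ∣ a - b := by
  have hu : IsUnit (∑ j ∈ Finset.range n, a ^ j * b ^ (n - 1 - j)) := by
    rw [isUnit_iff_constantCoeff]
    simp [ha, hb, hn]
  rw [← (Commute.all a b).geom_sum₂_mul n] at h
  exact (hu.dvd_mul_left).1 h

theorem eq_of_forall_X_pow_dvd_sub {a b : K⟦X⟧} (h : ∀ m : ℕ, X ^ (m + 1) ∣ a - b) : a = b := by
  ext n
  have := X_pow_dvd_iff.1 (h n) n (Nat.lt_succ_self n)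
  rwa [map_sub, sub_eq_zero] at this

end Congruence

end PowerSeries

/-! ### The Böttcher coordinate as an infinite product -/

section Formal

variable {K : Type*} [Field K]

/-- The `k`-th iterate of `x ↦ x ^ d + c x ^ (d + 1)`, as a formal power series. -/
noncomputable def gIter (d : ℕ) (c : K) : ℕ → K⟦X⟧
  | 0 => X
  | k + 1 => gIter d c k ^ d + C c * gIter d c k ^ (d + 1)

lemma gSeries_eq_mul (d : ℕ) (c : K) : gSeries d c = X ^ d * (1 + C c * X) := by
  rw [gSeries]; ring

lemma gIter_succ_eq_mul (d : ℕ) (c : K) (k : ℕ) :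
    gIter d c (k + 1) = gIter d c k ^ d * (1 + C c * gIter d c k) := by
  rw [gIter]; ring

lemma X_pow_dvd_gIter (d : ℕ) (c : K) (k : ℕ) : X ^ (d ^ k) ∣ gIter d c k := by
  induction k with
  | zero => simp [gIter]
  | succ k ih =>
    rw [gIter_succ_eq_mul, pow_succ, pow_mul]
    exact Dvd.dvd.mul_right (pow_dvd_pow_of_dvd ih d) _

lemma X_pow_dvd_gSeries (d : ℕ) (c : K) : X ^ d ∣ gSeries d c :=
  gSeries_eq_mul d c ▸ Dvd.intro _ rfl

variable {d : ℕ}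

lemma hasSubst_gSeries (hd : d ≠ 0) (c : K) : HasSubst (gSeries d c) :=
  HasSubst.of_constantCoeff_zero' <| by simp [gSeries, hd]

lemma constantCoeff_gIter (hd : d ≠ 0) (c : K) (k : ℕ) : constantCoeff (gIter d c k) = 0 := by
  have h := (pow_dvd_pow X (Nat.one_le_iff_ne_zero.2 (pow_ne_zero k hd))).trans
    (X_pow_dvd_gIter d c k)
  rwa [pow_one, X_dvd_iff] at h

lemma hasSubst_C_mul_gIter (hd : d ≠ 0) (c : K) (k : ℕ) : HasSubst (C c * gIter d c k) :=
  HasSubst.of_constantCoeff_zero' <| by simp [constantCoeff_gIter hd]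

lemma subst_C_mul {a : K⟦X⟧} (ha : HasSubst a) (c : K) (f : K⟦X⟧) :
    (C c * f).subst a = C c * f.subst a := by
  rw [← smul_eq_C_mul, ← smul_eq_C_mul, subst_smul ha]

lemma gIter_subst_gSeries (hd : d ≠ 0) (c : K) (k : ℕ) :
    (gIter d c k).subst (gSeries d c) = gIter d c (k + 1) := by
  have hg := hasSubst_gSeries hd c
  induction k with
  | zero => rw [gIter, subst_X hg, gSeries, gIter, gIter]
  | succ k ih =>
    rw [gIter, subst_add hg, subst_C_mul hg, subst_pow hg, subst_pow hg, ih, ← gIter]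

theorem isBottcherCoordinate_iff (hd : d ≠ 0) {c : K} {φ : K⟦X⟧} :
    IsBottcherCoordinate d (gSeries d c) φ ↔ ∃ u : K⟦X⟧, φ = X * u ∧ constantCoeff u = 1 ∧
      u ^ d = (1 + C c * X) * u.subst (gSeries d c) := by
  have hg := hasSubst_gSeries hd c
  have key (u : K⟦X⟧) : (X * u).subst (gSeries d c) = (X * u) ^ d ↔
      u ^ d = (1 + C c * X) * u.subst (gSeries d c) := by
    rw [subst_mul hg, subst_X hg, mul_pow]
    nth_rw 1 [gSeries_eq_mul]
    rw [mul_assoc, mul_right_inj' (pow_ne_zero d X_ne_zero), eq_comm]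
  constructor
  · intro h
    obtain ⟨u, rfl⟩ := X_dvd_iff.2 h.constantCoeff_eq
    refine ⟨u, rfl, ?_, (key u).1 h.bottcher_eq⟩
    simpa [coeff_succ_X_mul] using h.coeff_one_eq
  · rintro ⟨u, rfl, hu, h⟩
    exact ⟨by simp, by rw [← hu]; simp [coeff_succ_X_mul 0], (key u).2 h⟩

variable [CharZero K]

/-- The power series `(1 + c g_k(x)) ^ r`, where `g_k` is the `k`-th iterate of
`x ↦ x ^ d + c x ^ (d + 1)` and `r` is a rational exponent. -/
noncomputable def iterRpow (d : ℕ) (c : K) (r : ℚ) (k : ℕ) : K⟦X⟧ :=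
  (binomialSeries K r).subst (C c * gIter d c k)

lemma iterRpow_sub_one (hd : d ≠ 0) (c : K) (r : ℚ) (k : ℕ) :
    iterRpow d c r k - 1 = (binomialSeries K r - 1).subst (C c * gIter d c k) := by
  have h := hasSubst_C_mul_gIter hd c k
  rw [subst_sub h, iterRpow, ← coe_substAlgHom h, map_one]

lemma iterRpow_zero (hd : d ≠ 0) (c : K) (k : ℕ) : iterRpow d c 0 k = 1 := by
  have h := hasSubst_C_mul_gIter hd c k
  rw [iterRpow, binomialSeries_zero, ← coe_substAlgHom h, map_one]

lemma iterRpow_add (hd : d ≠ 0) (c : K) (r s : ℚ) (k : ℕ) :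
    iterRpow d c (r + s) k = iterRpow d c r k * iterRpow d c s k := by
  rw [iterRpow, binomialSeries_add, subst_mul (hasSubst_C_mul_gIter hd c k), iterRpow, iterRpow]

lemma iterRpow_one (hd : d ≠ 0) (c : K) (k : ℕ) : iterRpow d c 1 k = 1 + C c * gIter d c k := by
  have h := hasSubst_C_mul_gIter hd c k
  rw [iterRpow, ← Nat.cast_one, binomialSeries_nat, pow_one, subst_add h, subst_X h,
    ← coe_substAlgHom h, map_one]

lemma iterRpow_pow (hd : d ≠ 0) (c : K) (r : ℚ) (k n : ℕ) :
    iterRpow d c r k ^ n = iterRpow d c (n * r) k := by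
  induction n with
  | zero => simp [iterRpow_zero hd]
  | succ n ih => rw [pow_succ, ih, ← iterRpow_add hd]; congr 1; push_cast; ring

lemma iterRpow_subst_gSeries (hd : d ≠ 0) (c : K) (r : ℚ) (k : ℕ) :
    (iterRpow d c r k).subst (gSeries d c) = iterRpow d c r (k + 1) := by
  have hg := hasSubst_gSeries hd c
  rw [iterRpow, subst_comp_subst_apply (hasSubst_C_mul_gIter hd c k) hg, subst_C_mul hg,
    gIter_subst_gSeries hd, iterRpow]

lemma X_pow_dvd_iterRpow_sub_one (hd : d ≠ 0) (c : K) (r : ℚ) (k : ℕ) :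
    X ^ (d ^ k) ∣ iterRpow d c r k - 1 := by
  have h := hasSubst_C_mul_gIter hd c k
  have h1 : X ∣ binomialSeries K r - 1 := by rw [X_dvd_iff]; simp
  have h2 := X_pow_dvd_subst_sub_subst_left (a := binomialSeries K r) (b := 1) (i := 1) h
    ((X_pow_dvd_gIter d c k).mul_left _) (by simpa using h1)
  rw [mul_one, ← coe_substAlgHom h, map_one, coe_substAlgHom h] at h2
  exact h2

lemma constantCoeff_iterRpow (hd : d ≠ 0) (c : K) (r : ℚ) (k : ℕ) :
    constantCoeff (iterRpow d c r k) = 1 := by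
  have h := (dvd_pow_self X (pow_ne_zero k hd)).trans (X_pow_dvd_iterRpow_sub_one hd c r k)
  rw [X_dvd_iff, map_sub, map_one, sub_eq_zero] at h
  exact h

/-- The partial product `∏_{k < m} (1 + c g_k(x)) ^ (1 / d ^ (k + 1))` of the infinite product for
`φ(x) / x`, where `φ` is the Böttcher coordinate. -/
noncomputable def bottcherProd (d : ℕ) (c : K) (m : ℕ) : K⟦X⟧ :=
  ∏ k ∈ Finset.range m, iterRpow d c (1 / (d : ℚ) ^ (k + 1)) k

lemma constantCoeff_bottcherProd (hd : d ≠ 0) (c : K) (m : ℕ) :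
    constantCoeff (bottcherProd d c m) = 1 := by
  simp [bottcherProd, constantCoeff_iterRpow hd]

lemma bottcherProd_subst_gSeries (hd : d ≠ 0) (c : K) (m : ℕ) :
    (1 + C c * X) * (bottcherProd d c m).subst (gSeries d c) = bottcherProd d c (m + 1) ^ d := by
  have hd' : (d : ℚ) ≠ 0 := Nat.cast_ne_zero.2 hd
  rw [bottcherProd, bottcherProd, Finset.prod_range_succ', mul_pow, mul_comm, ← Finset.prod_pow,
    ← coe_substAlgHom (hasSubst_gSeries hd c), map_prod]
  congr 1
  · refine Finset.prod_congr rfl fun k _ => ?_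
    rw [coe_substAlgHom, iterRpow_subst_gSeries hd, iterRpow_pow hd]
    congr 1
    field_simp
    ring
  · rw [iterRpow_pow hd, zero_add, pow_one, mul_one_div_cancel hd', iterRpow_one hd, gIter]

/-- A solution of `u ^ d = (1 + c x) u(g(x))` with constant term `1` agrees with the partial
products to growing order; in particular it is unique. -/
theorem X_pow_dvd_sub_bottcherProd (hd : 2 ≤ d) {c : K} {u : K⟦X⟧} (hu : constantCoeff u = 1)
    (h : u ^ d = (1 + C c * X) * u.subst (gSeries d c)) (m : ℕ) :
    X ^ (m + 1) ∣ u - bottcherProd d c m := by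
  have hd0 : d ≠ 0 := by omega
  induction m with
  | zero => rw [zero_add, pow_one, X_dvd_iff]; simp [hu, bottcherProd]
  | succ m ih =>
    refine X_pow_dvd_sub_of_pow_sub_pow hu (constantCoeff_bottcherProd hd0 c _) hd0 ?_
    rw [h, ← bottcherProd_subst_gSeries hd0, ← mul_sub]
    refine Dvd.dvd.mul_left (.trans (pow_dvd_pow _ ?_) (X_pow_dvd_subst_sub_subst_left
      (hasSubst_gSeries hd0 c) (X_pow_dvd_gSeries d c) ih)) _
    nlinarith

lemma X_pow_dvd_bottcherProd_succ_sub (hd : 2 ≤ d) (c : K) (m : ℕ) :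
    X ^ (m + 1) ∣ bottcherProd d c (m + 1) - bottcherProd d c m := by
  rw [bottcherProd, Finset.prod_range_succ, ← bottcherProd, ← mul_sub_one]
  exact Dvd.dvd.mul_left ((pow_dvd_pow _ (Nat.lt_pow_self hd)).trans
    (X_pow_dvd_iterRpow_sub_one (by omega) c _ m)) _

/-- The infinite product `∏_k (1 + c g_k(x)) ^ (1 / d ^ (k + 1))`, defined as the `X`-adic limit of
its partial products. -/
noncomputable def bottcherUnit (d : ℕ) (c : K) : K⟦X⟧ :=
  mk fun n => coeff n (bottcherProd d c n)

lemma X_pow_dvd_bottcherUnit_sub (hd : 2 ≤ d) (c : K) (m : ℕ) :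
    X ^ (m + 1) ∣ bottcherUnit d c - bottcherProd d c m := by
  rw [X_pow_dvd_iff]
  intro n hn
  rw [map_sub, bottcherUnit, coeff_mk, sub_eq_zero]
  obtain ⟨l, rfl⟩ := Nat.exists_eq_add_of_le (Nat.lt_succ_iff.1 hn)
  clear hn
  induction l with
  | zero => rfl
  | succ l ih =>
    have := X_pow_dvd_iff.1 (X_pow_dvd_bottcherProd_succ_sub hd c (n + l)) n (by omega)
    rw [map_sub, sub_eq_zero] at this
    rw [ih, ← add_assoc, this]

lemma bottcherUnit_pow (hd : 2 ≤ d) (c : K) :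
    bottcherUnit d c ^ d = (1 + C c * X) * (bottcherUnit d c).subst (gSeries d c) := by
  have hd0 : d ≠ 0 := by omega
  refine eq_of_forall_X_pow_dvd_sub fun m => ?_
  have h1 : X ^ (m + 1) ∣ bottcherUnit d c ^ d - bottcherProd d c (m + 1) ^ d :=
    ((pow_dvd_pow _ (Nat.le_succ _)).trans (X_pow_dvd_bottcherUnit_sub hd c (m + 1))).trans
      (sub_dvd_pow_sub_pow _ _ d)
  have h2 : X ^ (m + 1) ∣ (bottcherUnit d c).subst (gSeries d c)
      - (bottcherProd d c m).subst (gSeries d c) :=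
    (pow_dvd_pow _ (by nlinarith)).trans (X_pow_dvd_subst_sub_subst_left
      (hasSubst_gSeries hd0 c) (X_pow_dvd_gSeries d c) (X_pow_dvd_bottcherUnit_sub hd c m))
  rw [← bottcherProd_subst_gSeries hd0] at h1
  convert h1.sub (h2.mul_left (1 + C c * X)) using 1
  ring

theorem existsUnique_isBottcherCoordinate (hd : 2 ≤ d) (c : K) :
    ∃! φ : K⟦X⟧, IsBottcherCoordinate d (gSeries d c) φ := by
  have hd0 : d ≠ 0 := by omega
  refine ⟨X * bottcherUnit d c, (isBottcherCoordinate_iff hd0).2 ⟨_, rfl, ?_,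
    bottcherUnit_pow hd c⟩, fun φ hφ => ?_⟩
  · simp [← coeff_zero_eq_constantCoeff_apply, bottcherUnit, bottcherProd]
  · obtain ⟨u, rfl, hu, h⟩ := (isBottcherCoordinate_iff hd0).1 hφ
    congr 1
    refine eq_of_forall_X_pow_dvd_sub fun m => ?_
    simpa using (X_pow_dvd_sub_bottcherProd hd hu h m).sub (X_pow_dvd_bottcherUnit_sub hd c m)

end Formal

/-! ### Gauss norms of power series -/

section CoeffBound

variable {K : Type*} [NormedField K]

/-- The Gauss norm of `f` at radius `ρ` is at most `M`, i.e. `‖a_n‖ ρ ^ n ≤ M` for all coefficients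
`a_n` of `f`. -/
def CoeffBound (ρ M : ℝ) (f : K⟦X⟧) : Prop :=
  ∀ n, ‖coeff n f‖ * ρ ^ n ≤ M

namespace CoeffBound

variable {ρ M M' : ℝ} {f g : K⟦X⟧}

lemma nonneg (h : CoeffBound ρ M f) : 0 ≤ M := by
  have := h 0
  rw [pow_zero, mul_one] at this
  exact (norm_nonneg _).trans this

lemma mono (h : CoeffBound ρ M f) (hM : M ≤ M') : CoeffBound ρ M' f :=
  fun n => (h n).trans hM

lemma zero (hM : 0 ≤ M) : CoeffBound ρ M (0 : K⟦X⟧) := fun n => by simpa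

lemma one : CoeffBound ρ 1 (1 : K⟦X⟧) := fun n => by
  rw [coeff_one]; split_ifs with h <;> simp [h]

lemma X (hρ : 0 ≤ ρ) : CoeffBound ρ ρ (X : K⟦X⟧) := fun n => by
  rw [coeff_X]; split_ifs with h <;> simp [h, hρ]

lemma C_mul (c : K) (h : CoeffBound ρ M f) : CoeffBound ρ (‖c‖ * M) (C c * f) := fun n => by
  rw [coeff_C_mul, norm_mul, mul_assoc]
  exact mul_le_mul_of_nonneg_left (h n) (norm_nonneg _)

lemma neg (hf : CoeffBound ρ M f) : CoeffBound ρ M (-f) := fun n => by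
  rw [map_neg, norm_neg]; exact hf n

variable [IsUltrametricDist K]

lemma add (hρ : 0 ≤ ρ) (hf : CoeffBound ρ M f) (hg : CoeffBound ρ M g) :
    CoeffBound ρ M (f + g) := fun n => by
  rw [map_add]
  refine (mul_le_mul_of_nonneg_right (IsUltrametricDist.norm_add_le_max _ _)
    (pow_nonneg hρ n)).trans ?_
  rcases max_choice ‖coeff n f‖ ‖coeff n g‖ with h | h <;> rw [h]
  exacts [hf n, hg n]

lemma sub (hρ : 0 ≤ ρ) (hf : CoeffBound ρ M f) (hg : CoeffBound ρ M g) :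
    CoeffBound ρ M (f - g) := sub_eq_add_neg f g ▸ hf.add hρ hg.neg

lemma mul (hρ : 0 < ρ) (hf : CoeffBound ρ M f) (hg : CoeffBound ρ M' g) :
    CoeffBound ρ (M * M') (f * g) := fun n => by
  have hn := pow_pos hρ n
  rw [coeff_mul, ← le_div_iff₀ hn]
  refine IsUltrametricDist.norm_sum_le_of_forall_le_of_nonneg
    (div_nonneg (mul_nonneg hf.nonneg hg.nonneg) hn.le) fun x hx => ?_
  rw [le_div_iff₀ hn, norm_mul, ← Finset.HasAntidiagonal.mem_antidiagonal.1 hx, pow_add, mul_mul_mul_comm]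
  exact mul_le_mul (hf _) (hg _) (by positivity) hf.nonneg

lemma pow (hρ : 0 < ρ) (hf : CoeffBound ρ M f) (n : ℕ) : CoeffBound ρ (M ^ n) (f ^ n) := by
  induction n with
  | zero => simpa using one
  | succ n ih => rw [pow_succ, pow_succ]; exact ih.mul hρ hf

lemma pow_sub_pow (hρ : 0 < ρ) {θ : ℝ} (hf : CoeffBound ρ M f) (hg : CoeffBound ρ M g)
    (hfg : CoeffBound ρ (θ * M) (f - g)) (hθ : 0 ≤ θ) (n : ℕ) :
    CoeffBound ρ (θ * M ^ n) (f ^ n - g ^ n) := by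
  induction n with
  | zero => simpa using zero hθ
  | succ n ih =>
    have h : f ^ (n + 1) - g ^ (n + 1) = f ^ n * (f - g) + (f ^ n - g ^ n) * g := by ring
    rw [h]
    refine add hρ.le (((hf.pow hρ n).mul hρ hfg).mono (le_of_eq ?_))
      ((ih.mul hρ hg).mono (le_of_eq ?_)) <;> ring

lemma mul_sub_one (hρ : 0 < ρ) (hM : M ≤ 1) (hf : CoeffBound ρ M (f - 1))
    (hg : CoeffBound ρ M (g - 1)) : CoeffBound ρ M (f * g - 1) := by
  have h : f * g - 1 = (f - 1) * ((g - 1) + 1) + (g - 1) := by ring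
  rw [h]
  exact add hρ.le (((hf.mul hρ ((hg.mono hM).add hρ.le one))).mono (mul_one M).le) hg

lemma prod_sub_one {ι : Type*} (hρ : 0 < ρ) (hM0 : 0 ≤ M) (hM : M ≤ 1) (s : Finset ι)
    {F : ι → K⟦X⟧} (h : ∀ i ∈ s, CoeffBound ρ M (F i - 1)) :
    CoeffBound ρ M ((∏ i ∈ s, F i) - 1) := by
  classical
  induction s using Finset.induction_on with
  | empty => simpa using zero hM0
  | insert i s hi ih =>
    rw [Finset.prod_insert hi]
    exact mul_sub_one hρ hM (h i (Finset.mem_insert_self _ _))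
      (ih fun j hj => h j (Finset.mem_insert_of_mem hj))

lemma finsum_norm_le {ι : Type*} {F : ι → K} (hM : 0 ≤ M) (h : ∀ i, ‖F i‖ ≤ M) :
    ‖∑ᶠ i, F i‖ ≤ M :=
  finsum_induction (p := fun x => ‖x‖ ≤ M) (by simpa)
    (fun _ _ hx hy => (IsUltrametricDist.norm_add_le_max _ _).trans (max_le hx hy)) h

/-- Substitution is contracting for Gauss norms: a series bounded by `M` at radius `s`, evaluated at
a series bounded by `s`, is bounded by `M`. -/
lemma subst (hρ : 0 < ρ) {s : ℝ} (hf : CoeffBound s M f) (hg : CoeffBound ρ s g)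
    (hs : HasSubst g) : CoeffBound ρ M (f.subst g) := fun n => by
  have hn := pow_pos hρ n
  rw [coeff_subst' hs, ← le_div_iff₀ hn]
  refine finsum_norm_le (div_nonneg hf.nonneg hn.le) fun k => ?_
  rw [le_div_iff₀ hn, smul_eq_mul, norm_mul, mul_assoc]
  exact (mul_le_mul_of_nonneg_left (hg.pow hρ k n) (norm_nonneg _)).trans (hf k)

lemma subst_sub_subst (hρ : 0 < ρ) {s θ : ℝ} {a b : K⟦X⟧} (hf : CoeffBound s M f)
    (ha : CoeffBound ρ s a) (hb : CoeffBound ρ s b) (hab : CoeffBound ρ (θ * s) (a - b))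
    (hθ : 0 ≤ θ) (hsa : HasSubst a) (hsb : HasSubst b) :
    CoeffBound ρ (θ * M) (f.subst a - f.subst b) := fun n => by
  have hn := pow_pos hρ n
  rw [map_sub, coeff_subst' hsa, coeff_subst' hsb, ← finsum_sub_distrib
    (coeff_subst_finite' hsa f n) (coeff_subst_finite' hsb f n), ← le_div_iff₀ hn]
  refine finsum_norm_le (div_nonneg (mul_nonneg hθ hf.nonneg) hn.le) fun k => ?_
  rw [le_div_iff₀ hn, ← smul_sub, ← map_sub, smul_eq_mul, norm_mul, mul_assoc]
  refine (mul_le_mul_of_nonneg_left (pow_sub_pow hρ ha hb hab hθ k n) (norm_nonneg _)).trans ?_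
  rw [mul_left_comm]
  exact mul_le_mul_of_nonneg_left (hf k) hθ

end CoeffBound

lemma coeff_eq_of_X_pow_dvd_sub {f g : K⟦X⟧} {m n : ℕ} (h : X ^ m ∣ f - g) (hn : n < m) :
    coeff n f = coeff n g := by
  have := X_pow_dvd_iff.1 h n hn
  rwa [map_sub, sub_eq_zero] at this

/-- The iterates of `t ↦ X - e(t)` starting from `X`. If `e = O(x ^ 2)`, they converge `X`-adically
to the compositional inverse of `X + e`. -/
noncomputable def substInvApprox (e : K⟦X⟧) : ℕ → K⟦X⟧
  | 0 => X
  | i + 1 => X - e.subst (substInvApprox e i)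

/-- A bound on the nonlinear part of `f = x + O(x ^ 2)` is inherited by its compositional
inverse `h`: the inverse is the `X`-adic limit of the iterates of `t ↦ X - (f - X)(t)`, which
satisfy the bound. -/
theorem CoeffBound.of_subst_eq_X [IsUltrametricDist K] {ρ θ : ℝ} (hρ : 0 < ρ) (hθ : θ ≤ 1)
    {f h : K⟦X⟧} (hf0 : constantCoeff f = 0) (hf1 : coeff 1 f = 1) (hh0 : constantCoeff h = 0)
    (hh1 : coeff 1 h = 1) (hfh : f.subst h = PowerSeries.X)
    (hf : CoeffBound ρ (θ * ρ) (f - PowerSeries.X)) :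
    CoeffBound ρ (θ * ρ) (h - PowerSeries.X) := by
  set e := f - PowerSeries.X with he
  have hsh : HasSubst h := HasSubst.of_constantCoeff_zero' hh0
  have hhe : h = PowerSeries.X - e.subst h := by
    rw [he, subst_sub hsh, hfh, subst_X hsh]; ring
  have hle : θ * ρ ≤ ρ := mul_le_of_le_one_left hρ.le hθ
  have he0 : constantCoeff e = 0 := by simp [he, hf0]
  have he1 : coeff 1 e = 0 := by simp [he, hf1]
  have key (i : ℕ) : constantCoeff (substInvApprox e i) = 0 ∧
      CoeffBound ρ (θ * ρ) (substInvApprox e i - PowerSeries.X) ∧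
      PowerSeries.X ^ (i + 2) ∣ h - substInvApprox e i := by
    induction i with
    | zero =>
      refine ⟨by simp [substInvApprox], by simpa [substInvApprox] using zero hf.nonneg, ?_⟩
      rw [X_pow_dvd_iff]
      intro m hm
      interval_cases m <;> simp [substInvApprox, hh0, hh1]
    | succ i ih =>
      obtain ⟨h0, hb, hX⟩ := ih
      have hst : HasSubst (substInvApprox e i) := HasSubst.of_constantCoeff_zero' h0
      have ht : CoeffBound ρ ρ (substInvApprox e i) := by
        simpa using (hb.mono hle).add hρ.le (CoeffBound.X hρ.le)
      refine ⟨?_, ?_, ?_⟩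
      · rw [substInvApprox, map_sub, constantCoeff_X, zero_sub, neg_eq_zero]
        exact constantCoeff_subst_eq_zero h0 e he0
      · rw [substInvApprox, sub_sub_cancel_left]
        exact (hf.subst hρ ht hst).neg
      · have h1 : h - substInvApprox e (i + 1) = e.subst (substInvApprox e i) - e.subst h := by
          rw [substInvApprox]; nth_rw 1 [hhe]; ring
        rw [h1]
        refine X_pow_dvd_subst_sub_subst hst hsh fun k => ?_
        match k with
        | 0 => exact Or.inl (by simpa using he0)
        | 1 => exact Or.inl he1
        | k + 2 =>
          right
          generalize substInvApprox e i = t at *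
          have hid : t ^ (k + 2) - h ^ (k + 2)
            = (t - h) * t ^ (k + 1) + (t ^ (k + 1) - h ^ (k + 1)) * h := by ring
          have hth : PowerSeries.X ^ (i + 2) ∣ t - h := by rw [← dvd_neg]; simpa using hX
          rw [hid, show i + 1 + 2 = i + 2 + 1 by ring, pow_succ PowerSeries.X (i + 2)]
          exact dvd_add
            (mul_dvd_mul hth ((X_dvd_iff.2 h0).trans (dvd_pow_self _ k.succ_ne_zero)))
            (mul_dvd_mul (hth.trans (sub_dvd_pow_sub_pow _ _ _)) (X_dvd_iff.2 hh0))
  intro n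
  obtain ⟨-, hb, hX⟩ := key n
  have := coeff_eq_of_X_pow_dvd_sub hX (n := n) (by omega)
  rw [map_sub, this, ← map_sub]
  exact hb n

end CoeffBound

/-! ### Gauss norms of the factors -/

section IterateBounds

variable {K : Type*} [NormedField K] {d : ℕ} {c : K} {ρ : ℝ}

lemma norm_mul_pow_le (hρ : 0 < ρ) (hρ1 : ρ ≤ 1) {n : ℕ} (hn : n ≠ 0) :
    ‖c‖ * ρ ^ n ≤ ‖c‖ * ρ :=
  mul_le_mul_of_nonneg_left (pow_le_of_le_one hρ.le hρ1 hn) (norm_nonneg c)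

lemma coeff_subst_C_mul_X_pow {D : ℕ} (hD : D ≠ 0) (c : K) (f : K⟦X⟧) (n : ℕ) :
    coeff (D * n) (f.subst (C c * X ^ D)) = coeff n f * c ^ n := by
  have h : HasSubst (C c * X ^ D) := HasSubst.of_constantCoeff_zero' (by simp [zero_pow hD])
  have hp (k : ℕ) : (C c * X ^ D) ^ k = C (c ^ k) * (X : K⟦X⟧) ^ (D * k) := by
    rw [mul_pow, ← pow_mul, map_pow]
  rw [coeff_subst' h, finsum_eq_single _ n]
  · rw [hp, coeff_C_mul, coeff_X_pow_self, mul_one, smul_eq_mul]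
  · intro k hk
    rw [hp, coeff_C_mul, coeff_X_pow, if_neg (by simpa [hD] using Ne.symm hk), mul_zero, smul_zero]

variable [IsUltrametricDist K]

lemma coeffBound_gIter (hd : d ≠ 0) (hρ : 0 < ρ) (hρ1 : ρ ≤ 1) (hc : ‖c‖ * ρ ≤ 1) (k : ℕ) :
    CoeffBound ρ (ρ ^ d ^ k) (gIter d c k) := by
  induction k with
  | zero => simpa [gIter] using CoeffBound.X hρ.le
  | succ k ih =>
    have h := (CoeffBound.one (ρ := ρ)).add hρ.le ((ih.C_mul c).mono
      ((norm_mul_pow_le hρ hρ1 (pow_ne_zero k hd)).trans hc))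
    rw [gIter_succ_eq_mul]
    exact ((ih.pow hρ d).mul hρ h).mono (by rw [mul_one, ← pow_mul, ← pow_succ])

lemma coeffBound_gIter_sub_X_pow (hd : d ≠ 0) (hρ : 0 < ρ) (hρ1 : ρ ≤ 1) (hc : ‖c‖ * ρ ≤ 1)
    (k : ℕ) : CoeffBound ρ (‖c‖ * ρ * ρ ^ d ^ k) (gIter d c k - X ^ d ^ k) := by
  have hcρ : 0 ≤ ‖c‖ * ρ := by positivity
  induction k with
  | zero => simpa [gIter] using CoeffBound.zero (by positivity)
  | succ k ih =>
    have hg := coeffBound_gIter hd hρ hρ1 hc k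
    have h1 := CoeffBound.pow_sub_pow hρ hg ((CoeffBound.X hρ.le).pow hρ (d ^ k)) ih hcρ d
    have h2 := (((hg.C_mul c).mono (norm_mul_pow_le hρ hρ1 (pow_ne_zero k hd))).mul hρ
      (hg.pow hρ d))
    rw [← pow_mul, ← pow_mul, ← pow_succ] at h1
    rw [← pow_mul, ← pow_succ] at h2
    convert h1.add hρ.le h2 using 1
    rw [gIter]; ring

lemma coeffBound_C_mul_gIter (hd : d ≠ 0) (hρ : 0 < ρ) (hρ1 : ρ ≤ 1) (hc : ‖c‖ * ρ ≤ 1) {k : ℕ}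
    {s : ℝ} (hs : ‖c‖ * ρ ^ d ^ k ≤ s) : CoeffBound ρ s (C c * gIter d c k) :=
  ((coeffBound_gIter hd hρ hρ1 hc k).C_mul c).mono hs

variable [CharZero K]

lemma coeffBound_iterRpow_sub_one (hd : d ≠ 0) (hρ : 0 < ρ) (hρ1 : ρ ≤ 1) (hc : ‖c‖ * ρ ≤ 1)
    {k : ℕ} {r : ℚ} {s μ : ℝ} (hs : ‖c‖ * ρ ^ d ^ k ≤ s)
    (hr : CoeffBound s μ (PowerSeries.binomialSeries K r - 1)) : CoeffBound ρ μ (iterRpow d c r k - 1) := by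
  rw [iterRpow_sub_one hd c]
  exact hr.subst hρ (coeffBound_C_mul_gIter hd hρ hρ1 hc hs) (hasSubst_C_mul_gIter hd c k)

/-- At the radius where `‖c g_N‖` reaches the boundary of the disk on which `(1 + x) ^ r - 1` is
bounded by `μ`, the coefficients of `(1 + c g_N(x)) ^ r` attain `μ` wherever those of
`(1 + x) ^ r` do, because `g_N(x)` is a small perturbation of `x ^ (d ^ N)`. -/
lemma le_norm_coeff_iterRpow (hd : d ≠ 0) (hρ : 0 < ρ) (hρ1 : ρ ≤ 1) (hc : ‖c‖ * ρ < 1) {N n : ℕ}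
    (hn : n ≠ 0) {r : ℚ} {s μ : ℝ} (hs : ‖c‖ * ρ ^ d ^ N = s) (hμ : 0 < μ)
    (hr : CoeffBound s μ (PowerSeries.binomialSeries K r - 1))
    (hrn : ‖coeff n (PowerSeries.binomialSeries K r)‖ * s ^ n = μ) :
    μ ≤ ‖coeff (d ^ N * n) (iterRpow d c r N)‖ * ρ ^ (d ^ N * n) := by
  have hD := pow_ne_zero N hd
  have hX : CoeffBound ρ s (C c * (X : K⟦X⟧) ^ d ^ N) :=
    (((CoeffBound.X hρ.le).pow hρ (d ^ N)).C_mul c).mono hs.le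
  have hdiff : CoeffBound ρ (‖c‖ * ρ * s) (C c * gIter d c N - C c * X ^ d ^ N) := by
    rw [← mul_sub]
    exact ((coeffBound_gIter_sub_X_pow hd hρ hρ1 hc.le N).C_mul c).mono
      (by rw [← hs]; exact le_of_eq (by ring))
  have hsX : HasSubst (C c * (X : K⟦X⟧) ^ d ^ N) :=
    HasSubst.of_constantCoeff_zero' (by simp [zero_pow hD])
  have h1 := CoeffBound.subst_sub_subst hρ hr (coeffBound_C_mul_gIter hd hρ hρ1 hc.le hs.le) hX
    hdiff (by positivity) (hasSubst_C_mul_gIter hd c N) hsX (d ^ N * n)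
  rw [← iterRpow_sub_one hd, map_sub, map_sub, coeff_subst_C_mul_X_pow hD, map_sub,
    coeff_one, coeff_one, if_neg hn, if_neg (mul_ne_zero hD hn), sub_zero, sub_zero] at h1
  by_contra! hlt
  have hpos := pow_pos hρ (d ^ N * n)
  have hlt' : ‖c‖ * ρ * μ < μ := mul_lt_of_lt_one_left hμ hc
  have heq : ‖coeff n (PowerSeries.binomialSeries K r) * c ^ n‖ * ρ ^ (d ^ N * n) = μ := by
    rw [norm_mul, norm_pow, pow_mul, mul_assoc, ← mul_pow, hs, hrn]
  refine absurd heq (ne_of_lt ?_)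
  rw [← lt_div_iff₀ hpos] at hlt ⊢
  rw [← le_div_iff₀ hpos] at h1
  have h2 := IsUltrametricDist.norm_add_le_max (coeff (d ^ N * n) (iterRpow d c r N))
    (-(coeff (d ^ N * n) (iterRpow d c r N) - coeff n (PowerSeries.binomialSeries K r) * c ^ n))
  rw [← sub_eq_add_neg, sub_sub_cancel, norm_neg] at h2
  exact h2.trans_lt (max_lt hlt (h1.trans_lt (by gcongr)))

/-- All factors but the `N`-th are invertible on a disk of radius `ρ'`, so a bound for the
infinite product on that disk gives a bound for the `N`-th factor. -/
lemma coeffBound_iterRpow_of_coeffBound {ρ' M μ : ℝ} (hd : d ≠ 0) (hρ : 0 < ρ')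
    (hρ1 : ρ' ≤ 1) (hc : ‖c‖ * ρ' ≤ 1) (hμ0 : 0 ≤ μ) (hμ : μ ≤ 1) {s : ℕ → ℝ} {N : ℕ}
    (hs : ∀ k ≠ N, ‖c‖ * ρ' ^ d ^ k ≤ s k)
    (hr : ∀ k, CoeffBound (s k) μ (PowerSeries.binomialSeries K (-(1 / (d : ℚ) ^ (k + 1))) - 1))
    {u : K⟦X⟧} (hu : ∀ m, X ^ (m + 1) ∣ u - bottcherProd d c m) (hM : CoeffBound ρ' M u) :
    CoeffBound ρ' M (iterRpow d c (1 / (d : ℚ) ^ (N + 1)) N) := fun n => by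
  set m := max n N + 1
  set W := ∏ k ∈ (Finset.range m).erase N, iterRpow d c (-(1 / (d : ℚ) ^ (k + 1))) k with hW
  have hWb : CoeffBound ρ' 1 W := by
    have h := CoeffBound.prod_sub_one hρ hμ0 hμ ((Finset.range m).erase N) fun k hk =>
      coeffBound_iterRpow_sub_one hd hρ hρ1 hc (hs k (Finset.ne_of_mem_erase hk)) (hr k)
    have h' := (h.mono hμ).add hρ.le CoeffBound.one
    rwa [sub_add_cancel] at h'
  have hUW : bottcherProd d c m * W = iterRpow d c (1 / (d : ℚ) ^ (N + 1)) N := by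
    rw [bottcherProd, ← Finset.mul_prod_erase _ _ (Finset.mem_range.2 (by omega : N < m)),
      mul_assoc, hW, ← Finset.prod_mul_distrib, Finset.prod_eq_one, mul_one]
    intro k _
    rw [← iterRpow_add hd, add_neg_cancel, iterRpow_zero hd]
  have hdvd : X ^ (m + 1) ∣ iterRpow d c (1 / (d : ℚ) ^ (N + 1)) N - u * W := by
    rw [← hUW, ← sub_mul, ← dvd_neg, ← neg_mul, neg_sub]
    exact (hu m).mul_right W
  rw [coeff_eq_of_X_pow_dvd_sub hdvd (by omega)]
  simpa using hM.mul hρ hWb n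

/-- The infinite product `u` has infinite Gauss norm at all radii beyond the radius `ρ` of the
`N`-th factor: otherwise that factor would have finite Gauss norm at `ρ'`, and its coefficients
would decay geometrically relative to `ρ`. -/
theorem not_coeffBound_of_lt {ρ' M μ : ℝ} (hd : d ≠ 0) (hρ : 0 < ρ) (hρρ' : ρ < ρ')
    (hρ1 : ρ' ≤ 1) (hcρ : ‖c‖ * ρ < 1) (hc : ‖c‖ * ρ' ≤ 1) (hμ0 : 0 < μ) (hμ : μ ≤ 1)
    {s : ℕ → ℝ} {N : ℕ} (hsN : ‖c‖ * ρ ^ d ^ N = s N) (hs : ∀ k ≠ N, ‖c‖ * ρ' ^ d ^ k ≤ s k)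
    (hrN : CoeffBound (s N) μ (PowerSeries.binomialSeries K (1 / (d : ℚ) ^ (N + 1)) - 1))
    (hr : ∀ k, CoeffBound (s k) μ (PowerSeries.binomialSeries K (-(1 / (d : ℚ) ^ (k + 1))) - 1))
    (hinf : ∀ m : ℕ, ∃ n ≥ m,
      ‖coeff n (PowerSeries.binomialSeries K (1 / (d : ℚ) ^ (N + 1)))‖ * s N ^ n = μ)
    {u : K⟦X⟧} (hu : ∀ m, X ^ (m + 1) ∣ u - bottcherProd d c m) : ¬ CoeffBound ρ' M u := by
  intro hM
  have hF := coeffBound_iterRpow_of_coeffBound hd (hρ.trans hρρ') hρ1 hc hμ0.le hμ hs hr hu hM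
  have hgt : 1 < ρ' / ρ := (one_lt_div hρ).2 hρρ'
  obtain ⟨m, hm⟩ := pow_unbounded_of_one_lt (M / μ) hgt
  obtain ⟨n, hnm, hn⟩ := hinf (m + 1)
  have hle := le_norm_coeff_iterRpow hd hρ (hρρ'.le.trans hρ1) hcρ (by omega) hsN hμ0 hrN hn
  have hmn : m ≤ d ^ N * n :=
    (by omega : m ≤ n).trans (Nat.le_mul_of_pos_left n (Nat.pos_of_ne_zero (pow_ne_zero N hd)))
  have h1 := hF (d ^ N * n)
  have h2 : M / μ < (ρ' / ρ) ^ (d ^ N * n) := hm.trans_le (pow_le_pow_right₀ hgt.le hmn)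
  rw [div_pow, div_lt_div_iff₀ hμ0 (by positivity)] at h2
  have hρ'0 : 0 < ρ' ^ (d ^ N * n) := pow_pos (hρ.trans hρρ') _
  have hρ0 : 0 < ρ ^ (d ^ N * n) := pow_pos hρ _
  have h3 := mul_le_mul_of_nonneg_left hle hρ'0.le
  have h4 := mul_le_mul_of_nonneg_right h1 hρ0.le
  linarith [h2, h3, h4]

theorem coeffBound_sub_one_of_forall_X_pow_dvd {μ : ℝ} (hd : d ≠ 0) (hρ : 0 < ρ) (hρ1 : ρ ≤ 1)
    (hc : ‖c‖ * ρ ≤ 1) (hμ0 : 0 ≤ μ) (hμ : μ ≤ 1) {s : ℕ → ℝ}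
    (hs : ∀ k, ‖c‖ * ρ ^ d ^ k ≤ s k)
    (hr : ∀ k, CoeffBound (s k) μ (PowerSeries.binomialSeries K (1 / (d : ℚ) ^ (k + 1)) - 1))
    {u : K⟦X⟧} (hu : ∀ m, X ^ (m + 1) ∣ u - bottcherProd d c m) :
    CoeffBound ρ μ (u - 1) := fun n => by
  rw [map_sub, coeff_eq_of_X_pow_dvd_sub (hu n) (Nat.lt_succ_self n), ← map_sub]
  exact CoeffBound.prod_sub_one hρ hμ0 hμ _ (fun k _ =>
    coeffBound_iterRpow_sub_one hd hρ hρ1 hc (hs k) (hr k)) n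

end IterateBounds

/-! ### The order of the radii of convergence of the factors -/

section Numeric
open Filter Topology

/-- The exponents behind the radii: with `‖c‖ = p ^ (-v)`, `‖d‖ = p ^ (-δ)` and `e = 1 / (p - 1)`,
the factor `(1 + c g_k) ^ (1 / d ^ (k + 1))` converges for `‖x‖ < p ^ ℓ_k`, where
`-v + d ^ k ℓ_k = -(k + 1) δ - e`. The hypotheses say that `ℓ_k` has its unique minimum at
`k = N`, so that all other factors converge on a larger disk, of radius `p ^ L'`. -/
lemma exists_gt_forall_ne_le {N d : ℕ} (hd : 2 ≤ d) {v δ e : ℝ} (hδ : 0 < δ) (he : 0 < e)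
    (hup : ((d : ℝ) - 1) * (v - (N + 1) * δ - e) < -δ)
    (hlow : N ≠ 0 → 0 < v ∧ -δ < ((d : ℝ) - 1) * (v - N * δ - e)) {L : ℝ}
    (hL : (d : ℝ) ^ N * L = v - (N + 1) * δ - e) :
    L < 0 ∧ L < v ∧ ∃ L' > L, L' ≤ 0 ∧ L' ≤ v ∧
      ∀ k ≠ N, -v + (d : ℝ) ^ k * L' ≤ -(k + 1) * δ - e := by
  have hd1 : (1 : ℝ) ≤ d - 1 := by
    have : (2 : ℝ) ≤ d := by exact_mod_cast hd
    linarith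
  have hdp (k : ℕ) : (0 : ℝ) < (d : ℝ) ^ k := by positivity
  have hL0 : L < 0 := by
    have h1 : (d : ℝ) ^ N * L < 0 := by rw [hL]; nlinarith
    exact (pos_iff_neg_of_mul_neg h1).1 (hdp N)
  have hLv : L < v := by
    rcases eq_or_ne N 0 with rfl | hN
    · simp only [pow_zero, one_mul, Nat.cast_zero, zero_add] at hL
      linarith
    · exact hL0.trans (hlow hN).1
  have hinc : δ + (d : ℝ) ^ N * (d - 1) * L < 0 := by
    have : (d : ℝ) ^ N * (d - 1) * L = (d - 1) * (v - (N + 1) * δ - e) := by rw [← hL]; ring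
    linarith
  have ev (a b : ℝ) (h : a + b * L < 0) : ∀ᶠ x in 𝓝[>] L, a + b * x < 0 :=
    ((by fun_prop : Continuous fun x => a + b * x).continuousAt.eventually_lt
      continuousAt_const h).filter_mono nhdsWithin_le_nhds
  have h1 := ev 0 1 (by linarith)
  have h2 := ev (-v) 1 (by linarith)
  have h3 := ev _ _ hinc
  have h4 := ev ((N + 2) * δ + e - v) ((d : ℝ) ^ (N + 1)) (by
    have : (d : ℝ) ^ (N + 1) * L = (d : ℝ) ^ N * (d - 1) * L + (d : ℝ) ^ N * L := by ring
    rw [this, hL]; linarith)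
  have h5 : ∀ᶠ x in 𝓝[>] L, ∀ k < N, (k + 1) * δ + e - v + (d : ℝ) ^ k * x ≤ 0 := by
    rcases N with - | M
    · simp
    have hlow' := (hlow M.succ_ne_zero).2
    have hdec : 0 < δ + (d : ℝ) ^ M * (d - 1) * L := by
      have hLM : (d : ℝ) ^ M * L * d = v - (M + 2) * δ - e := by
        have : (d : ℝ) ^ (M + 1) * L = (d : ℝ) ^ M * L * d := by ring
        push_cast at hL
        linarith
      push_cast at hlow'
      have h : 0 < (δ + (d : ℝ) ^ M * (d - 1) * L) * d := by
        have : (δ + (d : ℝ) ^ M * (d - 1) * L) * d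
          = δ * d + (d - 1) * ((d : ℝ) ^ M * L * d) := by ring
        rw [this, hLM]
        nlinarith
      exact pos_of_mul_pos_left h (by positivity)
    have h6 := ev ((M + 1) * δ + e - v) ((d : ℝ) ^ M) (by
      have : (d : ℝ) ^ (M + 1) * L = (d : ℝ) ^ M * (d - 1) * L + (d : ℝ) ^ M * L := by ring
      push_cast at hL; linarith)
    filter_upwards [h1, h6, self_mem_nhdsWithin] with x hx0 hx6 hxL k hk
    have hxL' : L < x := hxL
    have hdecx : 0 < δ + (d : ℝ) ^ M * (d - 1) * x := by
      have : 0 ≤ (d : ℝ) ^ M * (d - 1) * (x - L) :=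
        mul_nonneg (mul_nonneg (hdp M).le (by linarith)) (by linarith)
      linarith
    obtain ⟨j, hj⟩ := Nat.exists_eq_add_of_le (Nat.lt_succ_iff.1 hk)
    clear hk
    induction j generalizing k with
    | zero => obtain rfl : M = k := by omega
              exact hx6.le
    | succ j ih =>
      have h := ih (k + 1) (by omega)
      have hle : (d : ℝ) ^ k ≤ (d : ℝ) ^ M := pow_le_pow_right₀ (by linarith) (by omega)
      have h7 : (d : ℝ) ^ M * ((d - 1) * x) ≤ (d : ℝ) ^ k * ((d - 1) * x) :=
        mul_le_mul_of_nonpos_right hle (by nlinarith)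
      rw [pow_succ] at h
      push_cast at h
      linarith
  obtain ⟨x, hx1, hx2, hx3, hx4, hx5, hxL⟩ :=
    (h1.and (h2.and (h3.and (h4.and (h5.and self_mem_nhdsWithin))))).exists
  refine ⟨hL0, hLv, x, hxL, by linarith, by linarith, fun k hk => ?_⟩
  rcases lt_or_gt_of_ne hk with hk | hk
  · linarith [hx5 k hk]
  · obtain ⟨j, rfl⟩ := Nat.exists_eq_add_of_le (Nat.succ_le_of_lt hk)
    clear hk
    induction j with
    | zero => rw [Nat.add_zero]; push_cast at *; linarith
    | succ j ih =>
      have h := ih (by omega)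
      have hle : (d : ℝ) ^ N ≤ (d : ℝ) ^ (N.succ + j) :=
        pow_le_pow_right₀ (by linarith) (by omega)
      have h7 : (d : ℝ) ^ (N.succ + j) * ((d - 1) * x) ≤ (d : ℝ) ^ N * ((d - 1) * x) :=
        mul_le_mul_of_nonpos_right hle (by nlinarith)
      rw [← add_assoc, pow_succ]
      push_cast at *
      linarith

end Numeric

/-! ### `p`-adic size of binomial coefficients -/

section BinomialCoefficients

lemma choose_succ_mul (r : ℚ) (n : ℕ) :
    ((n + 1).factorial : ℚ) * Ring.choose r (n + 1) = (n.factorial * Ring.choose r n) * (r - n) := by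
  rw [← nsmul_eq_mul, ← nsmul_eq_mul, ← Ring.descPochhammer_eq_factorial_smul_choose,
    ← Ring.descPochhammer_eq_factorial_smul_choose, descPochhammer_succ_right,
    Polynomial.smeval_mul, Polynomial.smeval_sub, Polynomial.smeval_X, Polynomial.smeval_natCast]
  simp

lemma digits_sum_pos {p n : ℕ} (hn : n ≠ 0) : 0 < (p.digits n).sum :=
  List.sum_pos_iff_exists_pos_nat.2
    ⟨_, List.getLast_mem (Nat.digits_ne_nil_iff_ne_zero.2 hn),
      Nat.pos_of_ne_zero (Nat.getLast_digit_ne_zero p hn)⟩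

variable {p : ℕ} [hp : Fact p.Prime]

lemma digits_sum_prime_pow (j : ℕ) : (p.digits (p ^ j)).sum = 1 := by
  have : p.digits (p ^ j) = List.replicate j 0 ++ [1] := by
    have h := Nat.digits_base_pow_mul (k := j) (m := 1) hp.out.one_lt one_pos
    rwa [mul_one, Nat.digits_of_lt p 1 one_ne_zero hp.out.one_lt] at h
  simp [this]

variable {K : Type*} [NormedField K] [NormedAlgebra ℚ_[p] K]

lemma norm_natCast_eq_inv_pow {n : ℕ} (hn : n ≠ 0) : ‖(n : K)‖ = ((p : ℝ) ^ padicValNat p n)⁻¹ := by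
  have h := norm_algebraMap' K (n : ℚ_[p])
  rwa [Padic.norm_eq_zpow_neg_valuation (Nat.cast_ne_zero.2 hn), Padic.valuation_natCast, zpow_neg,
    zpow_natCast, map_natCast] at h

variable {μ : ℝ}

/-- Legendre's formula, in terms of `μ = p ^ (-1 / (p - 1))`. -/
lemma norm_factorial_mul (hμ : μ ^ (p - 1) = (p : ℝ)⁻¹) (n : ℕ) :
    ‖(n.factorial : K)‖ * μ ^ (p.digits n).sum = μ ^ n := by
  rw [norm_natCast_eq_inv_pow (p := p) n.factorial_ne_zero, ← inv_pow, ← hμ, ← pow_mul,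
    sub_one_mul_padicValNat_factorial, ← pow_add, Nat.sub_add_cancel (Nat.digit_sum_le p n)]

variable [CharZero K]

lemma norm_one_div_pow (d k : ℕ) :
    ‖((1 / (d : ℚ) ^ (k + 1) : ℚ) : K)‖ = (‖(d : K)‖ ^ (k + 1))⁻¹ := by
  push_cast
  rw [one_div, norm_inv, norm_pow]

lemma one_lt_norm_one_div_pow {d : ℕ} (hd0 : d ≠ 0) (hd : ‖(d : K)‖ < 1) (k : ℕ) :
    1 < ‖((1 / (d : ℚ) ^ (k + 1) : ℚ) : K)‖ := by
  have hdn0 : 0 < ‖(d : K)‖ := norm_pos_iff.2 (Nat.cast_ne_zero.2 hd0)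
  rw [norm_one_div_pow]
  exact (one_lt_inv₀ (pow_pos hdn0 _)).2 (pow_lt_one₀ hdn0.le hd k.succ_ne_zero)

variable [IsUltrametricDist K]

lemma norm_factorial_mul_coeff_binomialSeries {r : ℚ} (hr : 1 < ‖(r : K)‖) (n : ℕ) :
    ‖(n.factorial : K)‖ * ‖coeff n (PowerSeries.binomialSeries K r)‖
      = ‖(r : K)‖ ^ n := by
  have hcoe (n : ℕ) : (n.factorial : K) * coeff n (PowerSeries.binomialSeries K r)
      = ((n.factorial * Ring.choose r n : ℚ) : K) := by
    rw [binomialSeries_coeff, Rat.smul_one_eq_cast]; push_cast; rfl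
  rw [← norm_mul, hcoe]
  induction n with
  | zero => simp
  | succ n ih =>
    rw [choose_succ_mul, Rat.cast_mul, norm_mul, ih, pow_succ]
    congr 1
    have hlt : ‖-(n : K)‖ < ‖(r : K)‖ := by
      rw [norm_neg]; exact (IsUltrametricDist.norm_natCast_le_one _ n).trans_lt hr
    push_cast
    rw [sub_eq_add_neg, IsUltrametricDist.norm_add_eq_max_of_norm_ne_norm hlt.ne', max_eq_left hlt.le]

/-- The Gauss norm of `(1 + x) ^ r` at the radius `μ / |r|` can be read off from the digits:
the `n`-th term has norm `μ` to the sum of the `p`-adic digits of `n`. -/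
lemma norm_coeff_binomialSeries_mul (hμ0 : 0 < μ) (hμ : μ ^ (p - 1) = (p : ℝ)⁻¹) {r : ℚ}
    (hr : 1 < ‖(r : K)‖) (n : ℕ) :
    ‖coeff n (PowerSeries.binomialSeries K r)‖ * (μ / ‖(r : K)‖) ^ n
      = μ ^ (p.digits n).sum := by
  have hf : ‖(n.factorial : K)‖ ≠ 0 :=
    norm_ne_zero_iff.2 (Nat.cast_ne_zero.2 n.factorial_ne_zero)
  have hb : ‖coeff n (PowerSeries.binomialSeries K r)‖ ≠ 0 := by
    intro h0
    have h := norm_factorial_mul_coeff_binomialSeries hr n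
    rw [h0, mul_zero] at h
    exact (pow_pos (one_pos.trans hr) n).ne h
  rw [div_pow, ← norm_factorial_mul_coeff_binomialSeries hr n, ← norm_factorial_mul (K := K) hμ n]
  field_simp

lemma coeffBound_binomialSeries_sub_one (hμ0 : 0 < μ) (hμ1 : μ ≤ 1)
    (hμ : μ ^ (p - 1) = (p : ℝ)⁻¹) {r : ℚ} (hr : 1 < ‖(r : K)‖) :
    CoeffBound (μ / ‖(r : K)‖) μ (PowerSeries.binomialSeries K r - 1) := fun n => by
  rcases eq_or_ne n 0 with rfl | hn
  · simpa using hμ0.le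
  · rw [map_sub, coeff_one, if_neg hn, sub_zero, norm_coeff_binomialSeries_mul hμ0 hμ hr]
    exact pow_le_of_le_one hμ0.le hμ1 (digits_sum_pos hn).ne'

lemma norm_coeff_prime_pow_binomialSeries_mul (hμ0 : 0 < μ) (hμ : μ ^ (p - 1) = (p : ℝ)⁻¹) {r : ℚ}
    (hr : 1 < ‖(r : K)‖) (j : ℕ) :
    ‖coeff (p ^ j) (PowerSeries.binomialSeries K r)‖ * (μ / ‖(r : K)‖) ^ p ^ j = μ := by
  rw [norm_coeff_binomialSeries_mul hμ0 hμ hr, digits_sum_prime_pow, pow_one]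

variable {d : ℕ}

lemma coeffBound_binomialSeries_one_div_pow (hμ0 : 0 < μ) (hμ1 : μ ≤ 1)
    (hμ : μ ^ (p - 1) = (p : ℝ)⁻¹) (hd0 : d ≠ 0) (hd : ‖(d : K)‖ < 1) (k : ℕ) :
    CoeffBound (μ * ‖(d : K)‖ ^ (k + 1)) μ
      (PowerSeries.binomialSeries K (1 / (d : ℚ) ^ (k + 1)) - 1) := by
  have h := coeffBound_binomialSeries_sub_one hμ0 hμ1 hμ (one_lt_norm_one_div_pow hd0 hd k)
  rwa [norm_one_div_pow, div_inv_eq_mul] at h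

lemma coeffBound_binomialSeries_neg_one_div_pow (hμ0 : 0 < μ) (hμ1 : μ ≤ 1)
    (hμ : μ ^ (p - 1) = (p : ℝ)⁻¹) (hd0 : d ≠ 0) (hd : ‖(d : K)‖ < 1) (k : ℕ) :
    CoeffBound (μ * ‖(d : K)‖ ^ (k + 1)) μ
      (PowerSeries.binomialSeries K (-(1 / (d : ℚ) ^ (k + 1))) - 1) := by
  have hn : ‖((-(1 / (d : ℚ) ^ (k + 1)) : ℚ) : K)‖ = ‖((1 / (d : ℚ) ^ (k + 1) : ℚ) : K)‖ := by
    rw [Rat.cast_neg, norm_neg]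
  have h := coeffBound_binomialSeries_sub_one hμ0 hμ1 hμ
    (hn.symm ▸ one_lt_norm_one_div_pow hd0 hd k)
  rwa [hn, norm_one_div_pow, div_inv_eq_mul] at h

lemma exists_ge_norm_coeff_binomialSeries_eq (hμ0 : 0 < μ) (hμ : μ ^ (p - 1) = (p : ℝ)⁻¹)
    (hd0 : d ≠ 0) (hd : ‖(d : K)‖ < 1) (k m : ℕ) :
    ∃ n ≥ m, ‖coeff n (PowerSeries.binomialSeries K (1 / (d : ℚ) ^ (k + 1)))‖
      * (μ * ‖(d : K)‖ ^ (k + 1)) ^ n = μ := by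
  have h := norm_coeff_prime_pow_binomialSeries_mul hμ0 hμ (one_lt_norm_one_div_pow hd0 hd k) m
  rw [norm_one_div_pow, div_inv_eq_mul] at h
  exact ⟨p ^ m, (Nat.lt_pow_self hp.out.one_lt).le, h⟩

end BinomialCoefficients

/-! ### The constant `v_p((d - 1)!) / (d - 1)` -/

section LegendreBounds

variable {p : ℕ} [hp : Fact p.Prime] {d : ℕ}

lemma sub_one_mul_padicValNat_factorial_pred (hd : d ≠ 0) :
    (p - 1) * (padicValNat p (d - 1).factorial + padicValNat p d) + (p.digits d).sum = d := by
  have h := sub_one_mul_padicValNat_factorial (p := p) d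
  rw [← Nat.mul_factorial_pred hd, padicValNat.mul hd (Nat.factorial_ne_zero _)] at h
  rw [add_comm (padicValNat p (d - 1).factorial), h]
  exact Nat.sub_add_cancel (Nat.digit_sum_le p d)

/-- The constant `v_p((d - 1)!) / (d - 1)` of the hypotheses is at most
`1 / (p - 1) - v_p(d) / (d - 1)`, with equality for powers of `p`. -/
lemma padicValNat_factorial_pred_div_le (hd : 2 ≤ d) :
    (padicValNat p (d - 1).factorial : ℝ) / ((d : ℝ) - 1)
      ≤ 1 / ((p : ℝ) - 1) - padicValNat p d / ((d : ℝ) - 1) := by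
  have hd1 : (0 : ℝ) < d - 1 := by
    have : (2 : ℝ) ≤ d := by exact_mod_cast hd
    linarith
  have hp1 : (0 : ℝ) < p - 1 := by
    have : (1 : ℝ) < p := by exact_mod_cast hp.out.one_lt
    linarith
  have h := sub_one_mul_padicValNat_factorial_pred (p := p) (d := d) (by omega)
  have hs := digits_sum_pos (p := p) (n := d) (by omega)
  have h' : ((p : ℝ) - 1) * (padicValNat p (d - 1).factorial + padicValNat p d) ≤ d - 1 := by
    have : ((p - 1 : ℕ) : ℝ) * (padicValNat p (d - 1).factorial + padicValNat p d) + 1 ≤ d := by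
      exact_mod_cast (by omega)
    rw [Nat.cast_pred hp.out.pos] at this
    linarith
  rw [le_sub_iff_add_le, ← add_div, div_le_div_iff₀ hd1 hp1]
  linarith

lemma padicValNat_factorial_pred_div_eq {k : ℕ} (hd : 2 ≤ p ^ k) :
    (padicValNat p (p ^ k - 1).factorial : ℝ) / (((p ^ k : ℕ) : ℝ) - 1)
      = 1 / ((p : ℝ) - 1) - padicValNat p (p ^ k) / (((p ^ k : ℕ) : ℝ) - 1) := by
  have hd1 : (0 : ℝ) < ((p ^ k : ℕ) : ℝ) - 1 := by
    have : (2 : ℝ) ≤ (p ^ k : ℕ) := by exact_mod_cast hd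
    linarith
  have hp1 : (0 : ℝ) < p - 1 := by
    have : (1 : ℝ) < p := by exact_mod_cast hp.out.one_lt
    linarith
  have h := sub_one_mul_padicValNat_factorial_pred (p := p) (d := p ^ k) (by omega)
  rw [digits_sum_prime_pow] at h
  have h' : ((p - 1 : ℕ) : ℝ) * (padicValNat p (p ^ k - 1).factorial + padicValNat p (p ^ k)) + 1
      = (p ^ k : ℕ) := by exact_mod_cast h
  rw [Nat.cast_pred hp.out.pos] at h'
  rw [eq_sub_iff_add_eq, ← add_div, div_eq_div_iff hd1.ne' hp1.ne']
  linarith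

end LegendreBounds

/-! ### Gauss norms at nearby radii -/

section InverseRadius

namespace CoeffBound

variable {K : Type*} [NormedField K] {ρ M : ℝ} {f : K⟦X⟧}

lemma mono_radius {ρ' : ℝ} (hρ' : 0 ≤ ρ') (hle : ρ' ≤ ρ) (h : CoeffBound ρ M f) :
    CoeffBound ρ' M f := fun n =>
  (mul_le_mul_of_nonneg_left (pow_le_pow_left₀ hρ' hle n) (norm_nonneg _)).trans (h n)

lemma of_X_mul (hρ : 0 < ρ) (h : CoeffBound ρ M (PowerSeries.X * f)) : CoeffBound ρ (M / ρ) f :=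
  fun n => by
    have := h (n + 1)
    rw [coeff_succ_X_mul, pow_succ, ← mul_assoc] at this
    rwa [le_div_iff₀ hρ]

/-- Interpolation between two radii: a Gauss norm strictly below `ρ` at radius `ρ` stays below the
radius at slightly larger radii, provided it is finite at some larger radius. -/
lemma exists_gt_of_lt {μ ρ'' : ℝ} (hρ : 0 < ρ) (hμ0 : 0 ≤ μ) (hμ : μ < 1) (hlt : ρ < ρ'')
    (h : CoeffBound ρ (μ * ρ) f) (h'' : CoeffBound ρ'' M f) :
    ∃ ρ' > ρ, CoeffBound ρ' ρ' f := by
  have hρ'' : 0 < ρ'' := hρ.trans hlt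
  have hM' : 0 < M + 1 := by linarith [h''.nonneg]
  obtain ⟨L, hL⟩ := exists_pow_lt_of_lt_one (div_pos hρ'' hM') hμ
  have hpos : 0 < ρ ^ L * ρ'' := by positivity
  -- `ρ'` is the weighted geometric mean of `ρ` and `ρ''` with weights `L : 1`.
  set ρ' := (ρ ^ L * ρ'') ^ (((L + 1 : ℕ) : ℝ)⁻¹)
  have hρ'0 : 0 < ρ' := Real.rpow_pos_of_pos hpos _
  have hρ' : ρ' ^ (L + 1) = ρ ^ L * ρ'' := Real.rpow_inv_natCast_pow hpos.le L.succ_ne_zero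
  refine ⟨ρ', ?_, fun n => ?_⟩
  · rw [gt_iff_lt, ← pow_lt_pow_iff_left₀ hρ.le hρ'0.le L.succ_ne_zero, hρ', pow_succ]
    gcongr
  · rw [← pow_le_pow_iff_left₀ (by positivity) hρ'0.le L.succ_ne_zero, hρ']
    have h1 : (‖coeff n f‖ * ρ' ^ n) ^ (L + 1)
        = (‖coeff n f‖ * ρ ^ n) ^ L * (‖coeff n f‖ * ρ'' ^ n) := by
      rw [mul_pow, ← pow_mul, mul_comm n, pow_mul, hρ']; ring
    rw [h1]
    calc (‖coeff n f‖ * ρ ^ n) ^ L * (‖coeff n f‖ * ρ'' ^ n) ≤ (μ * ρ) ^ L * (M + 1) :=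
          mul_le_mul (pow_le_pow_left₀ (by positivity) (h n) L) ((h'' n).trans (by linarith))
            (by positivity) (by positivity)
      _ = ρ ^ L * (μ ^ L * (M + 1)) := by rw [mul_pow]; ring
      _ ≤ ρ ^ L * ρ'' := by
          gcongr
          rw [lt_div_iff₀ hM'] at hL
          exact hL.le

end CoeffBound

end InverseRadius

/-! ### Convergence and isometries -/

section Convergence

variable {p : ℕ} [hp : Fact p.Prime]

lemma PadicComplex.exists_norm_mem_Ioo {a b : ℝ} (ha : 0 < a) (hab : a < b) :
    ∃ x : ℂ_[p], a < ‖x‖ ∧ ‖x‖ < b := by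
  have hp1 : (1 : ℝ) < p := by exact_mod_cast hp.out.one_lt
  obtain ⟨q, hq1, hq2⟩ := exists_rat_btwn (Real.logb_lt_logb hp1 ha hab)
  obtain ⟨x, hx⟩ := IsAlgClosed.exists_pow_nat_eq ((p : ℂ_[p]) ^ (-q.num)) q.pos
  have hnorm : ‖(p : ℂ_[p])‖ = (p : ℝ)⁻¹ := by
    rw [norm_natCast_eq_inv_pow (p := p) hp.out.ne_zero, padicValNat_self, pow_one]
  have hxn : ‖x‖ ^ q.den = (p : ℝ) ^ q.num := by
    rw [← norm_pow, hx, norm_zpow, hnorm, zpow_neg, inv_zpow, inv_inv]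
  have hx0 : 0 < ‖x‖ := by
    refine (norm_nonneg x).lt_of_ne' fun h0 => ?_
    rw [h0, zero_pow q.den_nz] at hxn
    exact (zpow_pos (one_pos.trans hp1) _).ne hxn
  have hlog : Real.logb p ‖x‖ = q := by
    have h := congrArg (Real.logb p) hxn
    rw [Real.logb_pow, ← Real.rpow_intCast, Real.logb_rpow (one_pos.trans hp1) hp1.ne'] at h
    have hden : (q.den : ℝ) ≠ 0 := Nat.cast_ne_zero.2 q.den_nz
    rw [Rat.cast_def, eq_div_iff hden, mul_comm, h]
  refine ⟨x, ?_, ?_⟩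
  · rwa [← Real.logb_lt_logb_iff hp1 ha hx0, hlog]
  · rwa [← Real.logb_lt_logb_iff hp1 hx0 (ha.trans hab), hlog]

variable {f : ℂ_[p]⟦X⟧} {ρ M : ℝ}

lemma CoeffBound.convergesAt (h : CoeffBound ρ M f) {x : ℂ_[p]} (hx : ‖x‖ < ρ) :
    ConvergesAt f x := by
  have hρ : 0 < ρ := (norm_nonneg x).trans_lt hx
  refine Summable.of_norm_bounded (g := fun n => M * (‖x‖ / ρ) ^ n)
    ((summable_geometric_of_lt_one (by positivity) ((div_lt_one hρ).2 hx)).mul_left M) fun n => ?_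
  rw [norm_mul, norm_pow, div_pow, ← mul_div_assoc, le_div_iff₀ (pow_pos hρ n), mul_right_comm]
  exact mul_le_mul_of_nonneg_right (h n) (by positivity)

lemma ConvergesAt.exists_coeffBound {x : ℂ_[p]} (h : ConvergesAt f x) :
    ∃ M, CoeffBound ‖x‖ M f := by
  obtain ⟨M, hM⟩ := h.tendsto_atTop_zero.norm.bddAbove_range
  refine ⟨M, fun n => ?_⟩
  rw [← norm_pow, ← norm_mul]
  exact hM ⟨n, rfl⟩

lemma isMaximalConvergentOpenDisk_of_forall_not_coeffBound (hρ : 0 < ρ) (h : CoeffBound ρ M f)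
    (hnot : ∀ ρ' > ρ, ∀ M', ¬ CoeffBound ρ' M' f) : IsMaximalConvergentOpenDisk f ρ := by
  refine ⟨fun x hx => h.convergesAt (mem_ball_zero_iff.1 hx), fun R hR => ?_⟩
  by_contra! hlt
  obtain ⟨x, hx1, hx2⟩ := PadicComplex.exists_norm_mem_Ioo (p := p) hρ hlt
  obtain ⟨M', hM'⟩ := (hR x (mem_ball_zero_iff.2 hx2)).exists_coeffBound
  exact hnot _ hx1 M' hM'

lemma norm_pow_succ_sub_pow_succ_le {x y : ℂ_[p]} {t : ℝ} (hx : ‖x‖ ≤ t) (hy : ‖y‖ ≤ t) (n : ℕ) :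
    ‖x ^ (n + 1) - y ^ (n + 1)‖ ≤ t ^ n * ‖x - y‖ := by
  have ht : 0 ≤ t := (norm_nonneg x).trans hx
  induction n with
  | zero => simp
  | succ n ih =>
    have h : x ^ (n + 1 + 1) - y ^ (n + 1 + 1)
      = x ^ (n + 1) * (x - y) + (x ^ (n + 1) - y ^ (n + 1)) * y := by ring
    rw [h]
    refine (IsUltrametricDist.norm_add_le_max _ _).trans (max_le ?_ ?_)
    · rw [norm_mul, norm_pow]
      gcongr
    · rw [norm_mul, pow_succ t, mul_right_comm]
      exact mul_le_mul ih hy (norm_nonneg _) (by positivity)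

/-- On `‖x‖ ≤ t`, the nonlinear part of `f = x + O(x ^ 2)` is a contraction with
factor `t / ρ`. -/
lemma norm_evalSeries_sub_sub_le (hf1 : coeff 1 f = 1)
    (h : CoeffBound ρ ρ (f - X)) {x y : ℂ_[p]} {t : ℝ} (ht : t < ρ) (hx : ‖x‖ ≤ t) (hy : ‖y‖ ≤ t) :
    ‖evalSeries f x - evalSeries f y - (x - y)‖ ≤ t / ρ * ‖x - y‖ := by
  have ht0 : 0 ≤ t := (norm_nonneg x).trans hx
  have hρ : 0 < ρ := ht0.trans_lt ht
  have hf : CoeffBound ρ ρ f := by simpa using h.add hρ.le (CoeffBound.X hρ.le)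
  have hsum {z : ℂ_[p]} (hz : ‖z‖ ≤ t) :
      HasSum (fun n => coeff n (f - X) * z ^ n) (evalSeries f z - z) := by
    have h1 : HasSum (fun n => coeff n f * z ^ n) (evalSeries f z) :=
      (hf.convergesAt (hz.trans_lt ht)).hasSum
    have h2 : HasSum (fun n => coeff n (X : ℂ_[p]⟦X⟧) * z ^ n) z := by
      convert hasSum_single 1 fun n hn => ?_ using 1
      · simp
      · simp [coeff_X, hn]
    simpa [sub_mul] using h1.sub h2
  have hS := (hsum hx).sub (hsum hy)
  have heq : evalSeries f x - evalSeries f y - (x - y)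
      = ∑' n, (coeff n (f - X) * x ^ n - coeff n (f - X) * y ^ n) := by
    rw [hS.tsum_eq]; ring
  rw [heq]
  refine IsUltrametricDist.norm_tsum_le_of_forall_le_of_nonneg (by positivity) fun n => ?_
  match n with
  | 0 => simpa using by positivity
  | 1 => simpa [hf1] using by positivity
  | n + 2 =>
    rw [← mul_sub, norm_mul]
    have h1 := h (n + 2)
    have h2 : (t / ρ) ^ (n + 1) ≤ t / ρ :=
      pow_le_of_le_one (by positivity) ((div_le_one hρ).2 ht.le) n.succ_ne_zero
    calc ‖coeff (n + 2) (f - X)‖ * ‖x ^ (n + 2) - y ^ (n + 2)‖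
        ≤ ‖coeff (n + 2) (f - X)‖ * (t ^ (n + 1) * ‖x - y‖) :=
          mul_le_mul_of_nonneg_left (norm_pow_succ_sub_pow_succ_le hx hy (n + 1)) (norm_nonneg _)
      _ = ‖coeff (n + 2) (f - X)‖ * ρ ^ (n + 1) * ((t / ρ) ^ (n + 1) * ‖x - y‖) := by
          rw [div_pow]; field_simp
      _ ≤ 1 * (t / ρ * ‖x - y‖) := by
          refine mul_le_mul ?_ (mul_le_mul_of_nonneg_right h2 (norm_nonneg _)) (by positivity)
            zero_le_one
          rw [pow_succ, ← mul_assoc] at h1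
          exact le_of_mul_le_mul_right (by rwa [one_mul]) hρ
      _ = t / ρ * ‖x - y‖ := one_mul _

/-- A series `f = x + O(x ^ 2)` whose Gauss norm at radius `ρ` is at most `ρ` is a bijective isometry
of the open disk of radius `ρ`; preimages of `y` are the fixed points of `x ↦ x - f x + y`. -/
theorem isBijectiveIsometryOn_ball (hf0 : constantCoeff f = 0) (hf1 : coeff 1 f = 1)
    (h : CoeffBound ρ ρ (f - X)) : IsBijectiveIsometryOn (evalSeries f) (Metric.ball 0 ρ) := by
  have hiso : ∀ x ∈ Metric.ball (0 : ℂ_[p]) ρ, ∀ y ∈ Metric.ball (0 : ℂ_[p]) ρ,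
      dist (evalSeries f x) (evalSeries f y) = dist x y := by
    intro x hx y hy
    rw [mem_ball_zero_iff] at hx hy
    rcases eq_or_ne x y with rfl | hxy
    · simp
    have hρ : 0 < ρ := (norm_nonneg x).trans_lt hx
    have hle := norm_evalSeries_sub_sub_le hf1 h (max_lt hx hy) (le_max_left _ _)
      (le_max_right _ _)
    have hlt : ‖evalSeries f x - evalSeries f y - (x - y)‖ < ‖x - y‖ :=
      hle.trans_lt (mul_lt_of_lt_one_left (norm_pos_iff.2 (sub_ne_zero.2 hxy))
        ((div_lt_one hρ).2 (max_lt hx hy)))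
    rw [dist_eq_norm, dist_eq_norm, ← sub_add_cancel (evalSeries f x - evalSeries f y) (x - y),
      IsUltrametricDist.norm_add_eq_max_of_norm_ne_norm hlt.ne, max_eq_right hlt.le]
  have hz : evalSeries f 0 = 0 := by
    rw [evalSeries, tsum_eq_single 0 fun n hn => by simp [hn]]
    simp [hf0]
  refine ⟨⟨fun x hx => ?_, fun x hx y hy hxy => ?_, fun y hy => ?_⟩, hiso⟩
  · have h0 := hiso x hx 0 (Metric.mem_ball_self (Metric.pos_of_mem_ball hx))
    rw [hz] at h0
    exact Metric.mem_ball.2 (h0.trans_lt hx)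
  · rw [← dist_eq_zero, ← hiso x hx y hy, hxy, dist_self]
  · have hyρ := mem_ball_zero_iff.1 hy
    have hρ : 0 < ρ := (norm_nonneg y).trans_lt hyρ
    set T : ℂ_[p] → ℂ_[p] := fun x => x - evalSeries f x + y with hT
    have hcontr {x x' : ℂ_[p]} (hx : ‖x‖ ≤ ‖y‖) (hx' : ‖x'‖ ≤ ‖y‖) :
        ‖T x - T x'‖ ≤ ‖y‖ / ρ * ‖x - x'‖ := by
      have h1 := norm_evalSeries_sub_sub_le hf1 h hyρ hx hx'
      have h2 : T x - T x' = -(evalSeries f x - evalSeries f x' - (x - x')) := by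
        simp only [hT]; ring
      rwa [h2, norm_neg]
    have hκ : ‖y‖ / ρ < 1 := (div_lt_one hρ).2 hyρ
    have hmaps : Set.MapsTo T (Metric.closedBall 0 ‖y‖) (Metric.closedBall 0 ‖y‖) := by
      intro x hx
      rw [mem_closedBall_zero_iff] at hx ⊢
      have h0 : T 0 = y := by simp [hT, hz]
      have h1 := hcontr hx (by simp : ‖(0 : ℂ_[p])‖ ≤ ‖y‖)
      rw [sub_zero, h0] at h1
      have h2 := IsUltrametricDist.norm_add_le_max (T x - y) y
      rw [sub_add_cancel] at h2
      exact h2.trans (max_le (h1.trans ((mul_le_of_le_one_left (norm_nonneg _) hκ.le).trans hx))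
        le_rfl)
    have hcw : ContractingWith ⟨‖y‖ / ρ, by positivity⟩ (hmaps.restrict T _ _) := by
      refine ⟨by exact_mod_cast hκ, LipschitzWith.of_dist_le_mul fun a b => ?_⟩
      rw [Subtype.dist_eq, Subtype.dist_eq, dist_eq_norm, dist_eq_norm]
      exact hcontr (mem_closedBall_zero_iff.1 a.2) (mem_closedBall_zero_iff.1 b.2)
    obtain ⟨x, hx, hfix, -⟩ := hcw.exists_fixedPoint' Metric.isClosed_closedBall.isComplete hmaps
      (x := 0) (by simp) (edist_ne_top _ _)
    refine ⟨x, mem_ball_zero_iff.2 ((mem_closedBall_zero_iff.1 hx).trans_lt hyρ), ?_⟩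
    have h3 : x - evalSeries f x + y = x := hfix
    linear_combination -h3

end Convergence

/-! ### The radius `r_N⁻¹` -/

section Radii

variable {p : ℕ} [hp : Fact p.Prime] {N d : ℕ} {c : ℂ_[p]}

lemma padicV_eq_of_ne_zero (hc : c ≠ 0) : padicV p c = ((-Real.logb p ‖c‖ : ℝ) : EReal) := by
  simp [padicV, hc]

lemma ne_zero_of_padicV_lt {b : ℝ} (h : padicV p c < b) : c ≠ 0 := by
  rintro rfl
  simp [padicV] at h

/-- Both hypotheses, in terms of the real number `v = v_p(c)`. For the exponents `ℓ_k` of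
`exists_gt_forall_ne_le`, the two inequalities with a factor `d - 1` say that `ℓ_N < ℓ_{N+1}`
and `ℓ_N < ℓ_{N-1}`. -/
lemma bounds_of_condition (hd : 2 ≤ d) (hc : ConditionA p N d c ∨ ConditionB p N d c) :
    c ≠ 0 ∧ 1 ≤ padicValNat p d ∧
      ((d : ℝ) - 1) * (-Real.logb p ‖c‖ - (N + 1) * padicValNat p d - 1 / ((p : ℝ) - 1))
        < -padicValNat p d ∧
      (N ≠ 0 → 0 < -Real.logb p ‖c‖ ∧ -(padicValNat p d : ℝ) <
        ((d : ℝ) - 1) * (-Real.logb p ‖c‖ - N * padicValNat p d - 1 / ((p : ℝ) - 1))) := by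
  have hd1 : (0 : ℝ) < d - 1 := by
    have : (2 : ℝ) ≤ d := by exact_mod_cast hd
    linarith
  have hmul (x : ℝ) : ((d : ℝ) - 1) * (x - padicValNat p d / ((d : ℝ) - 1))
      = (d - 1) * x - padicValNat p d := by field_simp
  rcases hc with ⟨rfl, hpd, hv⟩ | ⟨hN, ⟨k, rfl⟩, hlow, hv⟩
  · have hc0 := ne_zero_of_padicV_lt hv
    rw [padicV_eq_of_ne_zero hc0, EReal.coe_lt_coe_iff, condBound] at hv
    refine ⟨hc0, one_le_padicValNat_of_dvd (by omega) hpd, ?_, by simp⟩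
    have h := padicValNat_factorial_pred_div_le (p := p) hd
    have h2 := mul_lt_mul_of_pos_left (hv.trans_le (add_le_add_right h _)) hd1
    rw [← add_sub_assoc, hmul] at h2
    push_cast at h2 ⊢
    linarith
  · have hc0 := ne_zero_of_padicV_lt hv
    rw [padicV_eq_of_ne_zero hc0, EReal.coe_lt_coe_iff, condBound] at hlow hv
    have hk : k ≠ 0 := by rintro rfl; simp at hd
    refine ⟨hc0, one_le_padicValNat_of_dvd (by omega) (dvd_pow_self p hk), ?_, fun _ => ⟨?_, ?_⟩⟩
    · rw [padicValNat_factorial_pred_div_eq hd] at hv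
      have h2 := mul_lt_mul_of_pos_left hv hd1
      rw [← add_sub_assoc, hmul] at h2
      push_cast at h2 ⊢
      linarith
    · exact (by positivity : (0 : ℝ) ≤ _).trans_lt hlow
    · rw [padicValNat_factorial_pred_div_eq hd] at hlow
      have h2 := mul_lt_mul_of_pos_left hlow hd1
      rw [← add_sub_assoc, hmul] at h2
      push_cast at h2 ⊢
      linarith

/-- The radius `ρ = r_N⁻¹` is where the `N`-th factor stops converging; all the other factors
converge on a disk of some radius `ρ₁ > ρ`. Here `μ = p ^ (-1 / (p - 1))`. -/
theorem exists_radii (hd : 2 ≤ d) (hc : ConditionA p N d c ∨ ConditionB p N d c) :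
    ∃ ρ ρ₁ μ : ℝ, (rN p N d c)⁻¹ = ρ ∧ 0 < ρ ∧ ρ < 1 ∧ 0 < μ ∧ μ < 1 ∧
      μ ^ (p - 1) = (p : ℝ)⁻¹ ∧ ‖(d : ℂ_[p])‖ < 1 ∧ ‖c‖ * ρ < 1 ∧
      ‖c‖ * ρ ^ d ^ N = μ * ‖(d : ℂ_[p])‖ ^ (N + 1) ∧ ρ < ρ₁ ∧ ρ₁ ≤ 1 ∧ ‖c‖ * ρ₁ ≤ 1 ∧
      ∀ k ≠ N, ‖c‖ * ρ₁ ^ d ^ k ≤ μ * ‖(d : ℂ_[p])‖ ^ (k + 1) := by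
  obtain ⟨hc0, hδ, hup, hlow⟩ := bounds_of_condition hd hc
  have hp1 : (1 : ℝ) < p := by exact_mod_cast hp.out.one_lt
  have hp0 : (0 : ℝ) < p := one_pos.trans hp1
  have hδ' : (0 : ℝ) < padicValNat p d := by exact_mod_cast hδ
  have he : (0 : ℝ) < 1 / ((p : ℝ) - 1) := one_div_pos.2 (by linarith)
  have hcn : ‖c‖ = (p : ℝ) ^ (-(-Real.logb p ‖c‖)) := by
    rw [neg_neg, Real.rpow_logb hp0 hp1.ne' (norm_pos_iff.2 hc0)]
  have hdn : ‖(d : ℂ_[p])‖ = (p : ℝ) ^ (-(padicValNat p d : ℝ)) := by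
    rw [norm_natCast_eq_inv_pow (p := p) (by omega), Real.rpow_neg hp0.le, Real.rpow_natCast]
  set v := -Real.logb p ‖c‖
  set δ : ℝ := (padicValNat p d : ℝ)
  set e := 1 / ((p : ℝ) - 1) with he_def
  have hdN : (d : ℝ) ^ N ≠ 0 := pow_ne_zero N (by positivity)
  obtain ⟨hL0, hLv, L', hL', hL'0, hL'v, hk⟩ := exists_gt_forall_ne_le hd hδ' he hup hlow
    (mul_div_cancel₀ (v - (N + 1) * δ - e) hdN)
  set L := (v - (N + 1) * δ - e) / (d : ℝ) ^ N with hL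
  have hpow (x : ℝ) (k : ℕ) : ((p : ℝ) ^ x) ^ k = (p : ℝ) ^ (k * x) := by
    rw [← Real.rpow_natCast, ← Real.rpow_mul hp0.le, mul_comm]
  have hs (k : ℕ) : (p : ℝ) ^ (-e) * ‖(d : ℂ_[p])‖ ^ (k + 1) = (p : ℝ) ^ (-(k + 1) * δ - e) := by
    rw [hdn, hpow, ← Real.rpow_add hp0]; congr 1; push_cast; ring
  have hcr (x : ℝ) (k : ℕ) : ‖c‖ * ((p : ℝ) ^ x) ^ k = (p : ℝ) ^ (-v + k * x) := by
    rw [hcn, hpow, ← Real.rpow_add hp0]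
  refine ⟨(p : ℝ) ^ L, (p : ℝ) ^ L', (p : ℝ) ^ (-e), ?_, Real.rpow_pos_of_pos hp0 _,
    Real.rpow_lt_one_of_one_lt_of_neg hp1 hL0, Real.rpow_pos_of_pos hp0 _,
    Real.rpow_lt_one_of_one_lt_of_neg hp1 (by linarith), ?_, ?_, ?_, ?_,
    Real.rpow_lt_rpow_of_exponent_lt hp1 hL', Real.rpow_le_one_of_one_le_of_nonpos hp1.le hL'0,
    ?_, fun k hkN => ?_⟩
  · rw [rN, norm_div, norm_pow, hcn, hdn, hpow, ← Real.rpow_sub hp0, ← he_def,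
      ← Real.rpow_add hp0, ← Real.rpow_mul hp0.le, ← Real.rpow_neg hp0.le, hL]
    congr 1
    push_cast
    field_simp
    ring
  · have hp1' : ((p - 1 : ℕ) : ℝ) = p - 1 := Nat.cast_pred hp.out.pos
    rw [hpow, hp1', ← Real.rpow_neg_one]
    congr 1
    have : (p : ℝ) - 1 ≠ 0 := by linarith
    rw [he_def]
    field_simp
  · rw [hdn]
    exact Real.rpow_lt_one_of_one_lt_of_neg hp1 (by linarith)
  · have h := hcr L 1
    rw [pow_one, Nat.cast_one, one_mul] at h
    rw [h]
    exact Real.rpow_lt_one_of_one_lt_of_neg hp1 (by linarith)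
  · rw [hs, hcr, Nat.cast_pow, hL, mul_div_cancel₀ _ hdN]
    congr 1
    ring
  · have h := hcr L' 1
    rw [pow_one, Nat.cast_one, one_mul] at h
    rw [h]
    exact Real.rpow_le_one_of_one_le_of_nonpos hp1.le (by linarith)
  · rw [hs, hcr, Nat.cast_pow]
    exact Real.rpow_le_rpow_of_exponent_le hp1.le (hk k hkN)

end Radii

/-! ### The Böttcher coordinate and its inverse -/

theorem theorem1p3 (p : ℕ) [Fact p.Prime] (N d : ℕ) (hd : 2 ≤ d) (c : ℂ_[p])
    (hc : ConditionA p N d c ∨ ConditionB p N d c) :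
    1 < rN p N d c ∧
    (∃! φ : ℂ_[p]⟦X⟧, IsBottcherCoordinate d (gSeries d c) φ) ∧
    ∀ (φ : ℂ_[p]⟦X⟧) (hφ : IsBottcherCoordinate d (gSeries d c) φ),
      IsMaximalConvergentOpenDisk φ (rN p N d c)⁻¹ ∧
      IsMaximalConvergentOpenDisk (φ.substInvOfIsUnit hφ.isUnit_coeff_one) (rN p N d c)⁻¹ ∧
      IsBijectiveIsometryOn (evalSeries φ) (Metric.ball 0 (rN p N d c)⁻¹) := by
  obtain ⟨ρ, ρ₁, μ, hρ, hρ0, hρ1, hμ0, hμ1, hμ, hdn, hcρ, hcN, hρρ₁, hρ₁1, hcρ₁, hk⟩ :=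
    exists_radii hd hc
  have hd0 : d ≠ 0 := by omega
  rw [hρ]
  refine ⟨?_, existsUnique_isBottcherCoordinate hd c, fun φ hφ => ?_⟩
  · rw [← inv_inv (rN p N d c), hρ]
    exact (one_lt_inv₀ hρ0).2 hρ1
  have hk' (k : ℕ) : ‖c‖ * ρ ^ d ^ k ≤ μ * ‖(d : ℂ_[p])‖ ^ (k + 1) := by
    rcases eq_or_ne k N with rfl | hkN
    · exact hcN.le
    · exact le_trans (by gcongr) (hk k hkN)
  obtain ⟨u, hφu, hu1, hu⟩ := (isBottcherCoordinate_iff hd0).1 hφ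
  have hdvd := X_pow_dvd_sub_bottcherProd hd hu1 hu
  have hub := coeffBound_sub_one_of_forall_X_pow_dvd hd0 hρ0 hρ1.le hcρ.le hμ0.le hμ1.le hk'
    (coeffBound_binomialSeries_one_div_pow hμ0 hμ1.le hμ hd0 hdn) hdvd
  have hφb : CoeffBound ρ (μ * ρ) (φ - X) := by
    have h := (CoeffBound.X hρ0.le).mul hρ0 hub
    rwa [mul_sub_one, ← hφu, mul_comm] at h
  have hμρ : μ * ρ ≤ ρ := mul_le_of_le_one_left hρ0.le hμ1.le
  have hnot : ∀ ρ' > ρ, ∀ M, ¬ CoeffBound ρ' M φ := by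
    intro ρ' hρ' M hM
    have hmin : ρ < min ρ' ρ₁ := lt_min hρ' hρρ₁
    have h := hM.mono_radius (hρ0.trans hmin).le (min_le_left _ _)
    rw [hφu] at h
    have hkmin (k : ℕ) (hkN : k ≠ N) :
        ‖c‖ * min ρ' ρ₁ ^ d ^ k ≤ μ * ‖(d : ℂ_[p])‖ ^ (k + 1) :=
      (mul_le_mul_of_nonneg_left (pow_le_pow_left₀ (hρ0.trans hmin).le (min_le_right _ _) _)
        (norm_nonneg c)).trans (hk k hkN)
    exact not_coeffBound_of_lt hd0 hρ0 hmin ((min_le_right _ _).trans hρ₁1) hcρ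
      ((mul_le_mul_of_nonneg_left (min_le_right _ _) (norm_nonneg c)).trans hcρ₁) hμ0 hμ1.le
      (s := fun k => μ * ‖(d : ℂ_[p])‖ ^ (k + 1)) hcN
      hkmin
      (coeffBound_binomialSeries_one_div_pow hμ0 hμ1.le hμ hd0 hdn N)
      (coeffBound_binomialSeries_neg_one_div_pow hμ0 hμ1.le hμ hd0 hdn)
      (exists_ge_norm_coeff_binomialSeries_eq hμ0 hμ hd0 hdn N) hdvd
      (h.of_X_mul (hρ0.trans hmin))
  have hψ0 : constantCoeff (φ.substInvOfIsUnit hφ.isUnit_coeff_one) = 0 :=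
    constantCoeff_substInvOfIsUnit _ _
  have hψ1 : coeff 1 (φ.substInvOfIsUnit hφ.isUnit_coeff_one) = 1 := by
    rw [coeff_one_substInvOfIsUnit, Units.val_inv_eq_inv_val, IsUnit.unit_spec,
      hφ.coeff_one_eq, inv_one]
  have hφψ := subst_substInvOfIsUnit_right φ hφ.constantCoeff_eq hφ.isUnit_coeff_one
  have hψφ := subst_substInvOfIsUnit_left φ hφ.constantCoeff_eq hφ.isUnit_coeff_one
  set ψ := φ.substInvOfIsUnit hφ.isUnit_coeff_one
  have hψb := CoeffBound.of_subst_eq_X hρ0 hμ1.le hφ.constantCoeff_eq hφ.coeff_one_eq hψ0 hψ1 hφψ hφb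
  have hb {f : ℂ_[p]⟦X⟧} {ρ' : ℝ} (hρ' : 0 < ρ') (h : CoeffBound ρ' ρ' (f - X)) :
      CoeffBound ρ' ρ' f := by
    simpa using h.add hρ'.le (CoeffBound.X hρ'.le)
  refine ⟨isMaximalConvergentOpenDisk_of_forall_not_coeffBound hρ0 (hb hρ0 (hφb.mono hμρ)) hnot,
    isMaximalConvergentOpenDisk_of_forall_not_coeffBound hρ0 (hb hρ0 (hψb.mono hμρ)) ?_,
    isBijectiveIsometryOn_ball hφ.constantCoeff_eq hφ.coeff_one_eq (hφb.mono hμρ)⟩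
  -- If `ψ` converged further, its nonlinear part would be small on a slightly larger disk, and
  -- inverting back would extend `φ` to that disk.
  intro ρ'' hρ'' M hM
  have hρ''0 := hρ0.trans hρ''
  obtain ⟨ρ', hρ', hψρ'⟩ := CoeffBound.exists_gt_of_lt (M := max M ρ'') hρ0 hμ0.le hμ1 hρ'' hψb
    ((hM.mono (le_max_left _ _)).sub hρ''0.le
      ((CoeffBound.X hρ''0.le).mono (le_max_right _ _)))
  have hρ'0 := hρ0.trans hρ'
  have h := CoeffBound.of_subst_eq_X hρ'0 le_rfl hψ0 hψ1 hφ.constantCoeff_eq hφ.coeff_one_eq hψφ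
    (hψρ'.mono (one_mul _).ge)
  rw [one_mul] at h
  exact hnot ρ' hρ' ρ' (hb hρ'0 h)
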